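/- Let $Q$ be a (Hausdorff) smooth $2$-manifold, $\rho$ a smooth Riemannian metric on $Q$, $h\in C^\infty(Q)$, and let $H:T^*Q\to\mathbb R$, $H(\alpha)=\tfrac12\langle\alpha,\rho^\sharp(\alpha)\rangle+h(q)$ for $\alpha\in T^*_qQ$. Let $\xi$ be a nowhere vanishing smooth one-form on $Q$ and let $\mathcal W\subset TT^*Q$ be the vertical subbundle whose fibre at $\alpha\in T_q^*Q$ is spanned by the vertical lift $\frac{d}{dt}\big|_{t=0}(\alpha+t\,\xi(q))$. Let $(q_0,0)\in T^*Q$ be a critical point of the Hamiltonian vector field $X_H$. Fix a smooth chart $(U,\varphi)$, $\varphi=(x,y)$, with $\varphi(q_0)=(0,0)$, that is adapted to $\xi$, i.e. $\xi$ and $dy$ span the same line in $T_q^*Q$ for all $q\in U$. Let $h(x,y)$ be the local expression of $h$, and let $\begin{pmatrix}a&b\\b&c\end{pmatrix}$ be the inverse of the matrix of $\rho$ in the coordinates $(x,y)$. Then the following are equivalent. (1) The system $(H,\mathcal W)$ is stabilizable at $(q_0,0)$, with this certified by a simple Lyapunov function: on an open neighbourhood $O$ of $(q_0,0)$ in $T^*Q$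 there are a smooth vector field $Y$ with values in $\mathcal W$, such that $(q_0,0)$ is a critical point of $X_H+Y$ at which $X_H+Y$ is stable in the sense of Lyapunov, and a function $V(\alpha)=\tfrac12\langle\alpha,\phi^\sharp(\alpha)\rangle+v(q)$, with $\phi$ a smooth Riemannian metric and $v$ a smooth function near $q_0$, such that $V(q_0,0)=0$, $V>0$ on $O\setminus\{(q_0,0)\}$, $\langle dV,X_H+Y\rangle\le0$ on $O$, and the Hessian of $v$ at $q_0$ is positive definite. (2) $\left[b\,h_{xx}+c\,h_{xy}\right](0,0)\neq0$ or $h_{xx}(0,0)>0$. -/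

import Mathlib

open Set Filter Topology Bundle
open scoped Manifold ContDiff

noncomputable section

namespace Underactuated

/-- The model plane. -/
abbrev Plane : Type := EuclideanSpace ℝ (Fin 2)

section Dynamics

variable {E H P : Type*} [NormedAddCommGroup E] [NormedSpace ℝ E] [TopologicalSpace H]
  (I : ModelWithCorners ℝ E H) [TopologicalSpace P] [ChartedSpace H P]

/-- Lyapunov stability at `α₀` of the vector field `X` given on `O`: trajectories starting close
enough to `α₀` stay as close to `α₀` as prescribed, for all positive times at which they exist. -/
def IsStableAt (X : ∀ α : P, TangentSpace I α) (O : Set P) (α₀ : P) : Prop :=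
  ∀ N ∈ 𝓝 α₀, ∃ N' ∈ 𝓝 α₀, ∀ (T : ℝ) (Γ : ℝ → P),
    IsMIntegralCurveOn (I := I) Γ X (Ico 0 T) → (∀ t ∈ Ico 0 T, Γ t ∈ O) → Γ 0 ∈ N' →
      ∀ t ∈ Ico 0 T, Γ t ∈ N

/-- The differential of a real function at a point. -/
def differential (V : P → ℝ) (α : P) : TangentSpace I α →L[ℝ] ℝ :=
  mfderiv I 𝓘(ℝ, ℝ) V α

/-- `V` is a Lyapunov function on `O` for the vector field `X` and its critical point `α₀`. -/
structure IsLyapunovFunction (X : ∀ α : P, TangentSpace I α) (O : Set P) (α₀ : P)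
    (V : P → ℝ) : Prop where
  critical : X α₀ = 0
  smooth : ContMDiffOn I 𝓘(ℝ, ℝ) ∞ V O
  zero : V α₀ = 0
  pos : ∀ α ∈ O, α ≠ α₀ → 0 < V α
  deriv_nonpos : ∀ α ∈ O, differential I V α (X α) ≤ 0

end Dynamics

section Cotangent

variable (Q : Type*) [TopologicalSpace Q] [ChartedSpace Plane Q] [IsManifold 𝓘(ℝ, Plane) ∞ Q]

/-- The cotangent bundle `T*Q`. Mathlib's bundle of continuous linear maps provides its
topology and its smooth structure. -/
abbrev CotangentBundle : Type _ :=
  TotalSpace (Plane →L[ℝ] ℝ) (fun q : Q => TangentSpace 𝓘(ℝ, Plane) q →L[ℝ] ℝ)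

/-- The model with corners of `T*Q`. -/
abbrev cotangentModel : ModelWithCorners ℝ (Plane × (Plane →L[ℝ] ℝ))
    (ModelProd Plane (Plane →L[ℝ] ℝ)) :=
  𝓘(ℝ, Plane).prod 𝓘(ℝ, Plane →L[ℝ] ℝ)

variable {Q}

/-- The point `(q, β)` of `T*Q`. -/
abbrev covector (q : Q) (β : TangentSpace 𝓘(ℝ, Plane) q →L[ℝ] ℝ) : CotangentBundle Q :=
  ⟨q, β⟩

/-- The vertical lift `d/dt|_{t=0} (α + t β)` of `β` at `α`. -/
def vlift (α : CotangentBundle Q) (β : TangentSpace 𝓘(ℝ, Plane) α.proj →L[ℝ] ℝ) :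
    TangentSpace cotangentModel α :=
  (mfderiv 𝓘(ℝ, ℝ) cotangentModel (fun t : ℝ => covector α.proj (α.snd + t • β)) 0
    (1 : ℝ) : Plane × (Plane →L[ℝ] ℝ))

/-- The actuation subbundle: at `α` it is spanned by the vertical lift of the one-form `ξ`. -/
def actuation (ξ : ∀ q : Q, TangentSpace 𝓘(ℝ, Plane) q →L[ℝ] ℝ) (α : CotangentBundle Q) :
    Submodule ℝ (TangentSpace cotangentModel α) :=
  Submodule.span ℝ {vlift α (ξ α.proj)}

/-- `g` is a smooth Riemannian metric on the set `U`. -/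
structure IsRiemannianMetricOn
    (g : ∀ q : Q, TangentSpace 𝓘(ℝ, Plane) q →L[ℝ] TangentSpace 𝓘(ℝ, Plane) q →L[ℝ] ℝ)
    (U : Set Q) : Prop where
  symm : ∀ q ∈ U, ∀ u w, g q u w = g q w u
  pos : ∀ q ∈ U, ∀ u, u ≠ 0 → 0 < g q u u
  smooth : ContMDiffOn 𝓘(ℝ, Plane) (𝓘(ℝ, Plane).prod 𝓘(ℝ, Plane →L[ℝ] Plane →L[ℝ] ℝ)) ∞
    (fun q => TotalSpace.mk' (Plane →L[ℝ] Plane →L[ℝ] ℝ)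
      (E := fun q : Q =>
        TangentSpace 𝓘(ℝ, Plane) q →L[ℝ] TangentSpace 𝓘(ℝ, Plane) q →L[ℝ] ℝ) q (g q)) U

/-- The map `g♯ : T*_q Q → T_q Q`, inverse of `u ↦ g(u, ·)`. -/
def sharp (g : ∀ q : Q, TangentSpace 𝓘(ℝ, Plane) q →L[ℝ] TangentSpace 𝓘(ℝ, Plane) q →L[ℝ] ℝ)
    (q : Q) : (TangentSpace 𝓘(ℝ, Plane) q →L[ℝ] ℝ) →L[ℝ] TangentSpace 𝓘(ℝ, Plane) q :=
  (g q).inverse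

/-- The simple (kinetic-plus-potential) function `α ↦ ½ ⟨α, g♯ α⟩ + w(q)` on `T*Q`. -/
def simpleFunction
    (g : ∀ q : Q, TangentSpace 𝓘(ℝ, Plane) q →L[ℝ] TangentSpace 𝓘(ℝ, Plane) q →L[ℝ] ℝ)
    (w : Q → ℝ) (α : CotangentBundle Q) : ℝ :=
  1 / 2 * α.snd (sharp g α.proj α.snd) + w α.proj

end Cotangent

section Coordinates

variable {Q : Type*} [TopologicalSpace Q] [ChartedSpace Plane Q] [IsManifold 𝓘(ℝ, Plane) ∞ Q]
  (φ : OpenPartialHomeomorph Q Plane)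

/-- The coordinate differential `dqⁱ` at `q`. -/
def coordForm (i : Fin 2) (q : Q) : TangentSpace 𝓘(ℝ, Plane) q →L[ℝ] ℝ :=
  mfderiv 𝓘(ℝ, Plane) 𝓘(ℝ, ℝ) (fun q' => φ q' i) q

/-- The coordinate vector `∂/∂qⁱ` at `q`. -/
def coordVector (i : Fin 2) (q : Q) : TangentSpace 𝓘(ℝ, Plane) q :=
  (mfderiv 𝓘(ℝ, Plane) 𝓘(ℝ, Plane) φ q).inverse (EuclideanSpace.single i (1 : ℝ) : Plane)

/-- The induced coordinates `(q, p)` on `T*Q`, with `pᵢ = ⟨α, ∂/∂qⁱ⟩`. -/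
def cotangentCoord (α : CotangentBundle Q) : Plane × Plane :=
  (φ α.proj, WithLp.toLp 2 fun i => α.snd (coordVector φ i α.proj))

/-- The inverse of the induced coordinates: `(q, p) ↦ ∑ pᵢ dqⁱ`. -/
def cotangentCoordSymm (z : Plane × Plane) : CotangentBundle Q :=
  covector (φ.symm z.1) (∑ i, z.2 i • coordForm φ i (φ.symm z.1))

/-- The Hamiltonian vector field
`∑ ∂H/∂pᵢ ∂/∂qⁱ - ∂H/∂qⁱ ∂/∂pᵢ` over the domain of the chart `φ` of `Q`. Changes of cotangent
coordinates preserve the canonical symplectic form, so all charts define the same field. -/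
def hamiltonianField (H : CotangentBundle Q → ℝ) (α : CotangentBundle Q) :
    TangentSpace cotangentModel α :=
  let z := cotangentCoord φ α
  let dH : Plane × Plane →L[ℝ] ℝ := fderiv ℝ (fun z' => H (cotangentCoordSymm φ z')) z
  let qdot : Plane := WithLp.toLp 2 fun i => dH (0, EuclideanSpace.single i 1)
  let pdot : Plane := WithLp.toLp 2 fun i => -dH (EuclideanSpace.single i 1, 0)
  (mfderiv 𝓘(ℝ, Plane × Plane) cotangentModel (cotangentCoordSymm φ) z (qdot, pdot) :
    Plane × (Plane →L[ℝ] ℝ))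

/-- The entries `⟨dqⁱ, g♯ dqʲ⟩` of the inverse of the matrix `g(∂/∂qⁱ, ∂/∂qʲ)`. -/
def cometricCoeff
    (g : ∀ q : Q, TangentSpace 𝓘(ℝ, Plane) q →L[ℝ] TangentSpace 𝓘(ℝ, Plane) q →L[ℝ] ℝ)
    (i j : Fin 2) (q : Q) : ℝ :=
  coordForm φ i q (sharp g q (coordForm φ j q))

/-- The second derivative at `q` of the local expression of `w` in the chart `φ`. -/
def hessian (w : Q → ℝ) (q : Q) : Plane →L[ℝ] Plane →L[ℝ] ℝ :=
  fderiv ℝ (fderiv ℝ (fun z => w (φ.symm z))) (φ q)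

/-- The second partial derivative `∂²w/∂qⁱ∂qʲ` at `q`. -/
def secondPartial (w : Q → ℝ) (i j : Fin 2) (q : Q) : ℝ :=
  hessian φ w q (EuclideanSpace.single i 1) (EuclideanSpace.single j 1)

/-- The chart `φ` is adapted to the rank one subbundle spanned by `ξ`, that is, the subbundle is
spanned by `dy`, where `(x, y)` are the coordinates of `φ`. -/
def IsAdapted (ξ : ∀ q : Q, TangentSpace 𝓘(ℝ, Plane) q →L[ℝ] ℝ) : Prop :=
  ∀ q ∈ φ.source, Submodule.span ℝ {ξ q} = Submodule.span ℝ {coordForm φ 1 q}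

/-- The system with Hamiltonian `H` and actuation `ξ` is stabilizable at `(q₀, 0)`, and this is
certified by a simple Lyapunov function: around `(q₀, 0)` there are a control law `Y` with values
in the actuation subbundle such that the closed-loop system `X_H + Y` is stable, and a simple
Lyapunov function `V = ½ ⟨α, g♯ α⟩ + v` for it, where the minimum `q₀` of `v` is nondegenerate. -/
def StabilizableBySimpleLyapunov (H : CotangentBundle Q → ℝ)
    (ξ : ∀ q : Q, TangentSpace 𝓘(ℝ, Plane) q →L[ℝ] ℝ) (q₀ : Q) : Prop :=
  ∃ (U : Set Q) (O : Set (CotangentBundle Q))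
    (Y : ∀ α : CotangentBundle Q, TangentSpace cotangentModel α)
    (g : ∀ q : Q, TangentSpace 𝓘(ℝ, Plane) q →L[ℝ] TangentSpace 𝓘(ℝ, Plane) q →L[ℝ] ℝ)
    (v : Q → ℝ),
    IsOpen U ∧ q₀ ∈ U ∧ U ⊆ φ.source ∧
    IsOpen O ∧ covector q₀ 0 ∈ O ∧ (∀ α ∈ O, α.proj ∈ U) ∧
    ContMDiffOn cotangentModel cotangentModel.tangent ∞
      (fun α => (⟨α, Y α⟩ : TangentBundle cotangentModel (CotangentBundle Q))) O ∧
    (∀ α ∈ O, Y α ∈ actuation ξ α) ∧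
    IsStableAt cotangentModel (fun α => hamiltonianField φ H α + Y α) O (covector q₀ 0) ∧
    IsRiemannianMetricOn g U ∧
    ContMDiffOn 𝓘(ℝ, Plane) 𝓘(ℝ, ℝ) ∞ v U ∧
    IsLyapunovFunction cotangentModel (fun α => hamiltonianField φ H α + Y α) O (covector q₀ 0)
      (simpleFunction g v) ∧
    (∀ u : Plane, u ≠ 0 → 0 < hessian φ v q₀ u u)

end Coordinates

end Underactuated

end

set_option linter.unusedSectionVars false

noncomputable section

namespace Underactuated

/-! ### Coordinate forms and coordinate vectors of a chart of `Q`. -/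

section CoordinateForms

variable {Q : Type*} [TopologicalSpace Q] [ChartedSpace Plane Q] [IsManifold 𝓘(ℝ, Plane) ∞ Q]
  {φ : OpenPartialHomeomorph Q Plane}

/-! In canonical coordinates `(x, y, p₀, p₁)` the control is a force on `p₁` alone. It changes `V`
at the rate `∂V/∂p₁` times the force, so the obstruction lives where `∂V/∂p₁ = 0`. Write `A` for the
matrix `(a b; b c)`.

Necessity (`potential_matching`, `pos_of_stabilizable`). Over a fixed base point, `∂V/∂p₁` vanishes
on the line of covectors `s w`, where `w` is `∂/∂x` lowered by the metric of `V`. There the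
derivative of `V` is `C s³ + (dv(k) - h_x) s` with `k = A w`. Being nonpositive for both signs of
`s`, it forces `dv(k) = h_x`. Differentiating at the minimum of `v`, where `dv = 0`, gives `0 < Hess
v(k, k) = k₀ h_xx + k₁ h_xy`. If `b h_xx + c h_xy = 0`, the right side is `w₀ (a c - b²) / c` times
`h_xx`, and both `w₀` and `(a c - b²) / c` are positive.

Sufficiency (`exists_matching`, `stabilizable_of_matching`). Seek `V = ½ (p₀² / f + f (p₁ - r p₀)²)
+ v`, so that `∂V/∂p₁ = f (p₁ - r p₀)`. A smooth force makes `V` constant as soon as the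
uncontrolled derivative of `V` vanishes on `p₁ = r p₀`. This amounts to one first order linear
equation for `f` (the cubic part in the momenta) and one for `v` (the linear part), both along the
field `A (1, r)`. Choosing `(m, m') = A⁻¹ n` with `n` a constant vector, and `r = m' / m`, makes
this field parallel to `n`: both equations are then solved by integration along straight lines.

The equation for `v` is `∂ₙ v = h_x m / f`. Its solution can be given a positive definite Hessian if
`Hess h(n, ∂/∂x) > 0` and `m > 0` at the origin, and `exists_direction` finds such an `n` exactly
from condition (2). Since `V` is then a conserved quantity with a strict minimum, stability follows
from `IsLyapunovFunction.isStableAt`. -/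

theorem chart_mdifferentiable (hφ : φ ∈ IsManifold.maximalAtlas 𝓘(ℝ, Plane) ∞ Q) :
    φ.MDifferentiable 𝓘(ℝ, Plane) 𝓘(ℝ, Plane) :=
  ⟨(contMDiffOn_of_mem_maximalAtlas hφ).mdifferentiableOn (by simp),
    (contMDiffOn_symm_of_mem_maximalAtlas hφ).mdifferentiableOn (by simp)⟩

/-- The differential of the chart `φ`, with values in the model plane. -/
def chartDeriv (φ : OpenPartialHomeomorph Q Plane) (q : Q) :
    TangentSpace 𝓘(ℝ, Plane) q →L[ℝ] Plane :=
  mfderiv 𝓘(ℝ, Plane) 𝓘(ℝ, Plane) φ q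

theorem isInvertible_chartDeriv (hφ : φ ∈ IsManifold.maximalAtlas 𝓘(ℝ, Plane) ∞ Q)
    {q : Q} (hq : q ∈ φ.source) : (chartDeriv φ q).IsInvertible :=
  ⟨(chart_mdifferentiable hφ).mfderiv hq, rfl⟩

theorem coordVector_eq (i : Fin 2) (q : Q) :
    coordVector φ i q = (chartDeriv φ q).inverse (EuclideanSpace.single i (1 : ℝ)) := rfl

theorem coordForm_apply (hφ : φ ∈ IsManifold.maximalAtlas 𝓘(ℝ, Plane) ∞ Q)
    {q : Q} (hq : q ∈ φ.source) (i : Fin 2) (u : TangentSpace 𝓘(ℝ, Plane) q) :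
    coordForm φ i q u = chartDeriv φ q u i := by
  have h1 : HasMFDerivAt 𝓘(ℝ, Plane) 𝓘(ℝ, ℝ) (EuclideanSpace.proj i : Plane →L[ℝ] ℝ) (φ q)
      (EuclideanSpace.proj i : Plane →L[ℝ] ℝ) :=
    (EuclideanSpace.proj i : Plane →L[ℝ] ℝ).hasFDerivAt.hasMFDerivAt
  have h2 := ((chart_mdifferentiable hφ).mdifferentiableAt hq).hasMFDerivAt
  have h3 := h1.comp q h2
  have h4 : coordForm φ i q = _ := h3.mfderiv
  rw [h4]; rfl

theorem coordForm_coordVector (hφ : φ ∈ IsManifold.maximalAtlas 𝓘(ℝ, Plane) ∞ Q)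
    {q : Q} (hq : q ∈ φ.source) (i j : Fin 2) :
    coordForm φ i q (coordVector φ j q) = if i = j then 1 else 0 := by
  rw [coordForm_apply hφ hq, coordVector_eq, (isInvertible_chartDeriv hφ hq).self_apply_inverse]
  simp

theorem tangent_eq_of_coordForm (hφ : φ ∈ IsManifold.maximalAtlas 𝓘(ℝ, Plane) ∞ Q)
    {q : Q} (hq : q ∈ φ.source) {u w : TangentSpace 𝓘(ℝ, Plane) q}
    (h : ∀ i, coordForm φ i q u = coordForm φ i q w) : u = w := by
  apply (isInvertible_chartDeriv hφ hq).injective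
  ext i
  simpa only [coordForm_apply hφ hq] using h i

theorem sum_coordForm_coordVector (hφ : φ ∈ IsManifold.maximalAtlas 𝓘(ℝ, Plane) ∞ Q)
    {q : Q} (hq : q ∈ φ.source) (u : TangentSpace 𝓘(ℝ, Plane) q) :
    ∑ i, coordForm φ i q u • coordVector φ i q = u := by
  apply tangent_eq_of_coordForm hφ hq
  intro j
  simp [coordForm_coordVector hφ hq]
  fin_cases j <;> simp

theorem sum_apply_coordVector (hφ : φ ∈ IsManifold.maximalAtlas 𝓘(ℝ, Plane) ∞ Q)
    {q : Q} (hq : q ∈ φ.source) (β : TangentSpace 𝓘(ℝ, Plane) q →L[ℝ] ℝ) :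
    ∑ i, β (coordVector φ i q) • coordForm φ i q = β := by
  ext u
  conv_rhs => rw [← sum_coordForm_coordVector hφ hq u]
  simp [mul_comm]

/-- The coordinate forms in the trivialization of the tangent bundle given by a preferred chart. -/
theorem coordForm_symmL (hφ : φ ∈ IsManifold.maximalAtlas 𝓘(ℝ, Plane) ∞ Q)
    {x q : Q} (hq : q ∈ φ.source) (hx : q ∈ (chartAt Plane x).source) (i : Fin 2) (u : Plane) :
    coordForm φ i q ((trivializationAt Plane (TangentSpace 𝓘(ℝ, Plane)) x).symmL ℝ q u) =
      fderiv ℝ (φ ∘ (chartAt Plane x).symm) (chartAt Plane x q) u i := by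
  have hx' : chartAt Plane x q ∈ (chartAt Plane x).target := (chartAt Plane x).map_source hx
  have hmem := IsManifold.chart_mem_maximalAtlas (I := 𝓘(ℝ, Plane)) (n := ∞) x
  have h1 : MDifferentiableAt 𝓘(ℝ, Plane) 𝓘(ℝ, Plane) (chartAt Plane x).symm (chartAt Plane x q) :=
    (chart_mdifferentiable hmem).mdifferentiableAt_symm hx'
  have h2 : MDifferentiableAt 𝓘(ℝ, Plane) 𝓘(ℝ, Plane) φ
      ((chartAt Plane x).symm (chartAt Plane x q)) := by
    rw [(chartAt Plane x).left_inv hx]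
    exact (chart_mdifferentiable hφ).mdifferentiableAt hq
  have h3 := mfderiv_comp_apply (chartAt Plane x q) h2 h1 u
  rw [mfderiv_eq_fderiv, (chartAt Plane x).left_inv hx] at h3
  rw [coordForm_apply hφ hq, TangentBundle.symmL_trivializationAt hx]
  simp only [modelWithCornersSelf_coe, range_id, mfderivWithin_univ]
  erw [h3]
  simp [chartDeriv]
  rfl

end CoordinateForms

/-! ### Smoothness of the induced coordinates on the cotangent bundle. -/

section CotangentCoordinates

variable {Q : Type*} [TopologicalSpace Q] [ChartedSpace Plane Q] [IsManifold 𝓘(ℝ, Plane) ∞ Q]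
  {φ : OpenPartialHomeomorph Q Plane}

theorem cotangentCoordSymm_snd_apply (z : Plane × Plane)
    (u : TangentSpace 𝓘(ℝ, Plane) (φ.symm z.1)) :
    (cotangentCoordSymm φ z).snd u = ∑ i, z.2 i * coordForm φ i (φ.symm z.1) u := by
  change (∑ i, z.2 i • coordForm φ i (φ.symm z.1)) u = _
  simp

theorem cotangentCoord_cotangentCoordSymm (hφ : φ ∈ IsManifold.maximalAtlas 𝓘(ℝ, Plane) ∞ Q)
    {z : Plane × Plane} (hz : z.1 ∈ φ.target) :
    cotangentCoord φ (cotangentCoordSymm φ z) = z := by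
  have hq : φ.symm z.1 ∈ φ.source := φ.map_target hz
  refine Prod.ext (φ.right_inv hz) ?_
  ext i
  refine (cotangentCoordSymm_snd_apply z _).trans ?_
  simp only [cotangentCoordSymm, coordForm_coordVector hφ hq]
  simp

theorem cotangentCoordSymm_cotangentCoord (hφ : φ ∈ IsManifold.maximalAtlas 𝓘(ℝ, Plane) ∞ Q)
    {α : CotangentBundle Q} (hα : α.proj ∈ φ.source) :
    cotangentCoordSymm φ (cotangentCoord φ α) = α := by
  obtain ⟨q, β⟩ := α
  have key : ∀ q', q' = q →
      covector q' (∑ i, β (coordVector φ i q) • coordForm φ i q') = ⟨q, β⟩ := by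
    rintro _ rfl
    rw [sum_apply_coordVector hφ hα β]
  exact key _ (φ.left_inv hα)

theorem contDiffAt_chart_transition {e e' : OpenPartialHomeomorph Q Plane}
    (he : e ∈ IsManifold.maximalAtlas 𝓘(ℝ, Plane) ∞ Q)
    (he' : e' ∈ IsManifold.maximalAtlas 𝓘(ℝ, Plane) ∞ Q)
    {q : Q} (hq : q ∈ e.source) (hq' : q ∈ e'.source) :
    ContDiffAt ℝ ∞ (e ∘ e'.symm) (e' q) := by
  rw [← contMDiffAt_iff_contDiffAt]
  refine ContMDiffAt.comp (I' := 𝓘(ℝ, Plane)) _ ?_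
    (contMDiffAt_symm_of_mem_maximalAtlas he' (e'.map_source hq'))
  rw [e'.left_inv hq']
  exact contMDiffAt_of_mem_maximalAtlas he hq

theorem inCoordinates_covector {x q : Q} (β : TangentSpace 𝓘(ℝ, Plane) q →L[ℝ] ℝ) (u : Plane) :
    ContinuousLinearMap.inCoordinates Plane (TangentSpace 𝓘(ℝ, Plane)) ℝ (fun _ : Q => ℝ)
      x q x q β u =
      β ((trivializationAt Plane (TangentSpace 𝓘(ℝ, Plane)) x).symmL ℝ q u) := by
  simp [ContinuousLinearMap.inCoordinates]

/-- The components of a smooth family of coordinate forms in a preferred chart. -/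
def coordFormIn (φ : OpenPartialHomeomorph Q Plane) (x : Q) (i : Fin 2) (q : Q) : Plane →L[ℝ] ℝ :=
  (EuclideanSpace.proj i : Plane →L[ℝ] ℝ) ∘L
    fderiv ℝ (φ ∘ (chartAt Plane x).symm) (chartAt Plane x q)

theorem contMDiffAt_coordFormIn (hφ : φ ∈ IsManifold.maximalAtlas 𝓘(ℝ, Plane) ∞ Q)
    {x q : Q} (hq : q ∈ φ.source) (hx : q ∈ (chartAt Plane x).source) (i : Fin 2) :
    ContMDiffAt 𝓘(ℝ, Plane) 𝓘(ℝ, Plane →L[ℝ] ℝ) ∞ (coordFormIn φ x i) q := by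
  have hmem := IsManifold.chart_mem_maximalAtlas (I := 𝓘(ℝ, Plane)) (n := ∞) x
  have h1 : ContDiffAt ℝ ∞ (fun z => (EuclideanSpace.proj i : Plane →L[ℝ] ℝ) ∘L
      fderiv ℝ (φ ∘ (chartAt Plane x).symm) z) (chartAt Plane x q) :=
    contDiffAt_const.clm_comp
      ((contDiffAt_chart_transition hφ hmem hq hx).fderiv_right (m := ∞) (by simp))
  exact h1.contMDiffAt.comp q (contMDiffAt_of_mem_maximalAtlas hmem hx)

/-- Read in the trivialization at the base point, `dqⁱ` is the `i`-th row of the Jacobian of a chart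
transition, so the covector becomes a sum of products of smooth functions. -/
theorem contMDiffAt_cotangentCoordSymm (hφ : φ ∈ IsManifold.maximalAtlas 𝓘(ℝ, Plane) ∞ Q)
    {z : Plane × Plane} (hz : z.1 ∈ φ.target) :
    ContMDiffAt 𝓘(ℝ, Plane × Plane) cotangentModel ∞ (cotangentCoordSymm φ) z := by
  have hq : φ.symm z.1 ∈ φ.source := φ.map_target hz
  set x := φ.symm z.1 with hx
  have hbase : ContMDiffAt 𝓘(ℝ, Plane × Plane) 𝓘(ℝ, Plane) ∞
      (fun z' : Plane × Plane => φ.symm z'.1) z :=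
    ContMDiffAt.comp (I' := 𝓘(ℝ, Plane)) z (contMDiffAt_symm_of_mem_maximalAtlas hφ hz)
      contDiff_fst.contMDiff.contMDiffAt
  refine (contMDiffAt_hom_bundle _).2 ⟨hbase, ?_⟩
  have hsm : ContMDiffAt 𝓘(ℝ, Plane × Plane) 𝓘(ℝ, Plane →L[ℝ] ℝ) ∞
      (fun z' : Plane × Plane => ∑ i, z'.2 i • coordFormIn φ x i (φ.symm z'.1)) z := by
    refine ContMDiffAt.sum fun i _ => ContMDiffAt.smul (I := 𝓘(ℝ, ℝ))
      (f := fun z' : Plane × Plane => z'.2 i)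
      (g := fun z' : Plane × Plane => coordFormIn φ x i (φ.symm z'.1)) ?_ ?_
    · have : ContDiff ℝ ∞ (fun z' : Plane × Plane => z'.2 i) := by fun_prop
      exact this.contMDiff.contMDiffAt
    · exact ContMDiffAt.comp (I' := 𝓘(ℝ, Plane)) (g := coordFormIn φ x i) z
        (contMDiffAt_coordFormIn hφ hq (mem_chart_source _ _) i) hbase
  refine hsm.congr_of_eventuallyEq ?_
  have h1 : ∀ᶠ z' : Plane × Plane in 𝓝 z, φ.symm z'.1 ∈ (chartAt Plane x).source :=
    hbase.continuousAt.eventually ((chartAt Plane x).open_source.mem_nhds (mem_chart_source _ _))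
  have h2 : ∀ᶠ z' : Plane × Plane in 𝓝 z, z'.1 ∈ φ.target :=
    continuousAt_fst.eventually (φ.open_target.mem_nhds hz)
  filter_upwards [h1, h2] with z' hz1 hz2
  ext u
  refine (inCoordinates_covector _ u).trans ?_
  refine (cotangentCoordSymm_snd_apply z' _).trans ?_
  rw [sum_apply]
  refine Finset.sum_congr rfl fun i _ => ?_
  erw [coordForm_symmL hφ (φ.map_target hz2) hz1]
  rfl

theorem tangentBundle_mk_congr {M : Type*} [TopologicalSpace M] {E H : Type*}
    [NormedAddCommGroup E] [NormedSpace ℝ E] [TopologicalSpace H] {I : ModelWithCorners ℝ E H}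
    [ChartedSpace H M] {x y : M} (h : x = y) (u : E) :
    (⟨x, u⟩ : TangentBundle I M) = ⟨y, u⟩ := by
  subst h; rfl

/-- The push-forward of a smooth vector field by a local parametrization `F` with smooth local
inverse `G` is smooth. -/
theorem contMDiffAt_pushforward {M : Type*} [TopologicalSpace M] {E E' H : Type*}
    [NormedAddCommGroup E] [NormedSpace ℝ E] [NormedAddCommGroup E'] [NormedSpace ℝ E']
    [TopologicalSpace H] {I : ModelWithCorners ℝ E H} [ChartedSpace H M] [IsManifold I ∞ M]
    {F : E' → M} {S : Set E'} (hS : IsOpen S) (hF : ContMDiffOn 𝓘(ℝ, E') I ∞ F S)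
    {G : M → E'} {x : M} (hG : ContMDiffAt I 𝓘(ℝ, E') ∞ G x) (hx : G x ∈ S)
    (hFG : ∀ᶠ y in 𝓝 x, F (G y) = y) {X : E' → E'} (hX : ContDiffAt ℝ ∞ X (G x)) :
    ContMDiffAt I I.tangent ∞
      (fun y => (⟨y, (mfderiv 𝓘(ℝ, E') I F (G y) (X (G y)) : E)⟩ : TangentBundle I M)) x := by
  have h1 := hF.contMDiffOn_tangentMapWithin (m := ∞) (by simp) hS.uniqueMDiffOn
  have h2 : ContMDiffAt 𝓘(ℝ, E') 𝓘(ℝ, E').tangent ∞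
      (fun z => (⟨z, X z⟩ : TangentBundle 𝓘(ℝ, E') E')) (G x) :=
    contMDiffAt_vectorSpace_iff_contDiffAt.2 hX
  have h3 := h2.comp x hG
  have h4 : ContMDiffAt 𝓘(ℝ, E').tangent I.tangent ∞ (tangentMapWithin 𝓘(ℝ, E') I F S)
      ⟨G x, X (G x)⟩ :=
    h1.contMDiffAt ((hS.preimage (FiberBundle.continuous_proj E' (TangentSpace 𝓘(ℝ, E')))).mem_nhds
      hx)
  have h5 := ContMDiffAt.comp x h4 h3
  refine h5.congr_of_eventuallyEq ?_
  filter_upwards [hFG, hG.continuousAt.eventually (hS.mem_nhds hx)] with y hy hyS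
  simp only [Function.comp_apply, tangentMapWithin, mfderivWithin_of_isOpen hS hyS]
  exact tangentBundle_mk_congr hy.symm _

/-- The coordinate vector is the push-forward of a constant field by `φ.symm`. -/
theorem contMDiffAt_coordVector (hφ : φ ∈ IsManifold.maximalAtlas 𝓘(ℝ, Plane) ∞ Q)
    {q : Q} (hq : q ∈ φ.source) (i : Fin 2) :
    ContMDiffAt 𝓘(ℝ, Plane) 𝓘(ℝ, Plane).tangent ∞
      (fun q' => (⟨q', coordVector φ i q'⟩ : TangentBundle 𝓘(ℝ, Plane) Q)) q := by
  have h := contMDiffAt_pushforward φ.open_target (contMDiffOn_symm_of_mem_maximalAtlas hφ)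
    (contMDiffAt_of_mem_maximalAtlas hφ hq) (φ.map_source hq)
    (φ.eventually_left_inverse hq) (X := fun _ => EuclideanSpace.single i (1 : ℝ))
    contDiffAt_const
  refine h.congr_of_eventuallyEq ?_
  filter_upwards [φ.open_source.mem_nhds hq] with y hy
  have : coordVector φ i y =
      mfderiv 𝓘(ℝ, Plane) 𝓘(ℝ, Plane) φ.symm (φ y) (EuclideanSpace.single i (1 : ℝ)) :=
    ((isInvertible_chartDeriv hφ hy).inverse_apply_eq).2
      (((chart_mdifferentiable hφ).mfderiv hy).apply_symm_apply _).symm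
  rw [this]

/-- The momenta pair the tautological covector, a smooth section over the identity of the total
space, with a smooth vector field pulled back from the base. -/
theorem contMDiffAt_cotangentCoord (hφ : φ ∈ IsManifold.maximalAtlas 𝓘(ℝ, Plane) ∞ Q)
    {α : CotangentBundle Q} (hα : α.proj ∈ φ.source) :
    ContMDiffAt cotangentModel 𝓘(ℝ, Plane × Plane) ∞ (cotangentCoord φ) α := by
  have hproj : ContMDiffAt cotangentModel 𝓘(ℝ, Plane) ∞
      (fun α : CotangentBundle Q => α.proj) α := contMDiffAt_proj _
  have h1 : ContMDiffAt cotangentModel 𝓘(ℝ, Plane) ∞ (fun α : CotangentBundle Q => φ α.proj) α :=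
    (contMDiffAt_of_mem_maximalAtlas hφ hα).comp α hproj
  have h2 : ∀ i, ContMDiffAt cotangentModel 𝓘(ℝ, ℝ) ∞
      (fun α : CotangentBundle Q => α.snd (coordVector φ i α.proj)) α := by
    intro i
    have h3 : ContMDiffAt cotangentModel 𝓘(ℝ, Plane).tangent ∞ (fun α : CotangentBundle Q =>
        (⟨α.proj, coordVector φ i α.proj⟩ : TangentBundle 𝓘(ℝ, Plane) Q)) α :=
      (contMDiffAt_coordVector hφ hα i).comp α hproj
    have h4 := ContMDiffAt.clm_bundle_apply (𝕜 := ℝ) (F₁ := Plane) (F₂ := ℝ)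
      (E₁ := TangentSpace 𝓘(ℝ, Plane)) (E₂ := fun _ : Q => ℝ)
      (b := fun α : CotangentBundle Q => α.proj) (ϕ := fun α : CotangentBundle Q => α.snd)
      (n := ∞) (v := fun α : CotangentBundle Q => coordVector φ i α.proj)
      (IB := 𝓘(ℝ, Plane)) (IM := cotangentModel) (x := α) contMDiffAt_id h3
    exact (Bundle.contMDiffAt_totalSpace.1 h4).2
  have h5 : ContMDiffAt cotangentModel 𝓘(ℝ, Plane) ∞ (fun α : CotangentBundle Q =>
      (WithLp.toLp 2 fun i => α.snd (coordVector φ i α.proj) : Plane)) α := by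
    have : ContMDiffAt cotangentModel 𝓘(ℝ, Fin 2 → ℝ) ∞ (fun α : CotangentBundle Q =>
      (fun i => α.snd (coordVector φ i α.proj) : Fin 2 → ℝ)) α := contMDiffAt_pi_space.2 h2
    exact (PiLp.contDiff_toLp (p := 2) (𝕜 := ℝ)).contMDiff.contMDiffAt.comp α this
  exact h1.prodMk_space h5

end CotangentCoordinates

/-! ### Metrics and cometrics in coordinates. -/

section MetricCoefficients

variable {Q : Type*} [TopologicalSpace Q] [ChartedSpace Plane Q] [IsManifold 𝓘(ℝ, Plane) ∞ Q]
  {φ : OpenPartialHomeomorph Q Plane}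
  {g : ∀ q : Q, TangentSpace 𝓘(ℝ, Plane) q →L[ℝ] TangentSpace 𝓘(ℝ, Plane) q →L[ℝ] ℝ} {U : Set Q}

/-- The entries `g(∂/∂qⁱ, ∂/∂qʲ)` of the matrix of `g`. -/
def metricCoeff (φ : OpenPartialHomeomorph Q Plane)
    (g : ∀ q : Q, TangentSpace 𝓘(ℝ, Plane) q →L[ℝ] TangentSpace 𝓘(ℝ, Plane) q →L[ℝ] ℝ)
    (i j : Fin 2) (q : Q) : ℝ :=
  g q (coordVector φ i q) (coordVector φ j q)

/-- `sharp` is defined by `inverse`, which is zero on maps that are not invertible, so invertibility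
must be known before it can be used. Positivity gives injectivity, and the plane and its dual have
equal dimension. -/
theorem isInvertible_of_pos {B : Plane →L[ℝ] Plane →L[ℝ] ℝ} (hB : ∀ u, u ≠ 0 → 0 < B u u) :
    B.IsInvertible := by
  have hinj : Function.Injective (B : Plane →ₗ[ℝ] Plane →L[ℝ] ℝ) := by
    rw [injective_iff_map_eq_zero]
    intro u hu
    by_contra hne
    have h1 := hB u hne
    rw [show B u = 0 from hu] at h1
    simp at h1
  have hdim : Module.finrank ℝ Plane = Module.finrank ℝ (Plane →L[ℝ] ℝ) :=
    (InnerProductSpace.toDual ℝ Plane).toLinearEquiv.finrank_eq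
  exact ⟨(LinearMap.linearEquivOfInjective _ hinj hdim).toContinuousLinearEquiv, by ext; rfl⟩

theorem IsRiemannianMetricOn.isInvertible (hg : IsRiemannianMetricOn g U) {q : Q} (hq : q ∈ U) :
    (g q).IsInvertible :=
  isInvertible_of_pos (B := g q) (hg.pos q hq)

theorem IsRiemannianMetricOn.apply_sharp (hg : IsRiemannianMetricOn g U) {q : Q} (hq : q ∈ U)
    (β : TangentSpace 𝓘(ℝ, Plane) q →L[ℝ] ℝ) : g q (sharp g q β) = β :=
  (hg.isInvertible hq).self_apply_inverse β

theorem sum_metricCoeff_cometricCoeff (hφ : φ ∈ IsManifold.maximalAtlas 𝓘(ℝ, Plane) ∞ Q)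
    (hg : IsRiemannianMetricOn g U) {q : Q} (hq : q ∈ U) (hq' : q ∈ φ.source) (i k : Fin 2) :
    ∑ j, metricCoeff φ g i j q * cometricCoeff φ g j k q = if i = k then 1 else 0 := by
  have h1 : coordForm φ k q (coordVector φ i q) =
      g q (sharp g q (coordForm φ k q)) (coordVector φ i q) := by
    rw [hg.apply_sharp hq]
  rw [hg.symm q hq, ← sum_coordForm_coordVector hφ hq' (sharp g q (coordForm φ k q)),
    coordForm_coordVector hφ hq'] at h1
  simp only [eq_comm (a := i), h1, metricCoeff, cometricCoeff, map_sum, map_smul,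
    smul_eq_mul, mul_comm]

theorem metricCoeff_symm (hg : IsRiemannianMetricOn g U) {q : Q} (hq : q ∈ U) (i j : Fin 2) :
    metricCoeff φ g i j q = metricCoeff φ g j i q := hg.symm q hq _ _

theorem metricCoeff_pos (hφ : φ ∈ IsManifold.maximalAtlas 𝓘(ℝ, Plane) ∞ Q)
    (hg : IsRiemannianMetricOn g U) {q : Q} (hq : q ∈ U) (hq' : q ∈ φ.source) {s t : ℝ}
    (hst : s ≠ 0 ∨ t ≠ 0) :
    0 < metricCoeff φ g 0 0 q * s ^ 2 + 2 * metricCoeff φ g 0 1 q * s * t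
      + metricCoeff φ g 1 1 q * t ^ 2 := by
  have hne : s • coordVector φ 0 q + t • coordVector φ 1 q ≠ 0 := by
    intro h0
    have h1 := congrArg (coordForm φ 0 q) h0
    have h2 := congrArg (coordForm φ 1 q) h0
    simp [coordForm_coordVector hφ hq'] at h1 h2
    tauto
  have h := hg.pos q hq _ hne
  have h10 := metricCoeff_symm (φ := φ) hg hq 1 0
  simp only [map_add, map_smul, add_apply, smul_apply, smul_eq_mul] at h
  simp only [metricCoeff] at h10 ⊢
  rw [h10] at h
  convert h using 1
  ring

theorem metricCoeff_zero_zero_pos (hφ : φ ∈ IsManifold.maximalAtlas 𝓘(ℝ, Plane) ∞ Q)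
    (hg : IsRiemannianMetricOn g U) {q : Q} (hq : q ∈ U) (hq' : q ∈ φ.source) :
    0 < metricCoeff φ g 0 0 q := by
  simpa using metricCoeff_pos hφ hg hq hq' (s := 1) (t := 0) (by simp)

theorem metricCoeff_det_pos (hφ : φ ∈ IsManifold.maximalAtlas 𝓘(ℝ, Plane) ∞ Q)
    (hg : IsRiemannianMetricOn g U) {q : Q} (hq : q ∈ U) (hq' : q ∈ φ.source) :
    0 < metricCoeff φ g 0 0 q * metricCoeff φ g 1 1 q - metricCoeff φ g 0 1 q ^ 2 := by
  have h0 := metricCoeff_zero_zero_pos hφ hg hq hq'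
  -- On this vector the quadratic form equals `g₀₀` times the determinant.
  have h := metricCoeff_pos hφ hg hq hq' (s := -metricCoeff φ g 0 1 q)
    (t := metricCoeff φ g 0 0 q) (Or.inr h0.ne')
  exact pos_of_mul_pos_right (a := metricCoeff φ g 0 0 q) (h.trans_eq (by ring)) h0.le

theorem contMDiffAt_metricCoeff (hφ : φ ∈ IsManifold.maximalAtlas 𝓘(ℝ, Plane) ∞ Q)
    (hg : IsRiemannianMetricOn g U) (hU : IsOpen U) {q : Q} (hq : q ∈ U) (hq' : q ∈ φ.source)
    (i j : Fin 2) :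
    ContMDiffAt 𝓘(ℝ, Plane) 𝓘(ℝ, ℝ) ∞ (metricCoeff φ g i j) q := by
  have h := ContMDiffAt.clm_bundle_apply₂ (𝕜 := ℝ) (F₁ := Plane) (F₂ := Plane) (F₃ := ℝ)
      (E₁ := TangentSpace 𝓘(ℝ, Plane)) (E₂ := TangentSpace 𝓘(ℝ, Plane)) (E₃ := fun _ : Q => ℝ)
      (b := fun q => q) (ψ := g) (n := ∞) (v := coordVector φ i) (w := coordVector φ j)
      (IB := 𝓘(ℝ, Plane)) (IM := 𝓘(ℝ, Plane)) (x := q)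
      ((hg.smooth q hq).contMDiffAt (hU.mem_nhds hq)) (contMDiffAt_coordVector hφ hq' i)
      (contMDiffAt_coordVector hφ hq' j)
  exact (Bundle.contMDiffAt_totalSpace.1 h).2

/-- The cometric is the inverse of the matrix of the metric. -/
theorem cometricCoeff_eq (hφ : φ ∈ IsManifold.maximalAtlas 𝓘(ℝ, Plane) ∞ Q)
    (hg : IsRiemannianMetricOn g U) {q : Q} (hq : q ∈ U) (hq' : q ∈ φ.source)
    {D : ℝ} (hD : D = metricCoeff φ g 0 0 q * metricCoeff φ g 1 1 q - metricCoeff φ g 0 1 q ^ 2) :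
    cometricCoeff φ g 0 0 q = metricCoeff φ g 1 1 q / D ∧
    cometricCoeff φ g 0 1 q = -metricCoeff φ g 0 1 q / D ∧
    cometricCoeff φ g 1 0 q = -metricCoeff φ g 0 1 q / D ∧
    cometricCoeff φ g 1 1 q = metricCoeff φ g 0 0 q / D := by
  have hD0 : D ≠ 0 := hD ▸ (metricCoeff_det_pos hφ hg hq hq').ne'
  have h := sum_metricCoeff_cometricCoeff hφ hg hq hq'
  have h00 := h 0 0
  have h01 := h 0 1
  have h10 := h 1 0
  have h11 := h 1 1
  simp only [Fin.sum_univ_two, metricCoeff_symm (φ := φ) hg hq 1 0, Fin.isValue, if_true,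
    zero_ne_one, one_ne_zero, if_false] at h00 h01 h10 h11
  refine ⟨?_, ?_, ?_, ?_⟩ <;> rw [eq_div_iff hD0, hD]
  · linear_combination metricCoeff φ g 1 1 q * h00 - metricCoeff φ g 0 1 q * h10
  · linear_combination metricCoeff φ g 1 1 q * h01 - metricCoeff φ g 0 1 q * h11
  · linear_combination metricCoeff φ g 0 0 q * h10 - metricCoeff φ g 0 1 q * h00
  · linear_combination metricCoeff φ g 0 0 q * h11 - metricCoeff φ g 0 1 q * h01

/-- The metric on the domain of the chart `φ` with the given coefficients. -/
def coordMetric (φ : OpenPartialHomeomorph Q Plane) (G₀ G₁ G₂ : Plane → ℝ) (q : Q) :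
    TangentSpace 𝓘(ℝ, Plane) q →L[ℝ] TangentSpace 𝓘(ℝ, Plane) q →L[ℝ] ℝ :=
  G₀ (φ q) • (coordForm φ 0 q).smulRight (coordForm φ 0 q) +
    G₁ (φ q) • ((coordForm φ 0 q).smulRight (coordForm φ 1 q) +
      (coordForm φ 1 q).smulRight (coordForm φ 0 q)) +
    G₂ (φ q) • (coordForm φ 1 q).smulRight (coordForm φ 1 q)

theorem coordMetric_apply (G₀ G₁ G₂ : Plane → ℝ) (q : Q) (u w : TangentSpace 𝓘(ℝ, Plane) q) :
    coordMetric φ G₀ G₁ G₂ q u w =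
      G₀ (φ q) * (coordForm φ 0 q u * coordForm φ 0 q w) +
      G₁ (φ q) * (coordForm φ 0 q u * coordForm φ 1 q w +
        coordForm φ 1 q u * coordForm φ 0 q w) +
      G₂ (φ q) * (coordForm φ 1 q u * coordForm φ 1 q w) := by
  rfl

theorem contMDiffAt_smulRight {E F : Type*} [NormedAddCommGroup E] [NormedSpace ℝ E]
    [NormedAddCommGroup F] [NormedSpace ℝ F] {β : Q → E →L[ℝ] ℝ} {η : Q → F} {q : Q}
    (hβ : ContMDiffAt 𝓘(ℝ, Plane) 𝓘(ℝ, E →L[ℝ] ℝ) ∞ β q)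
    (hη : ContMDiffAt 𝓘(ℝ, Plane) 𝓘(ℝ, F) ∞ η q) :
    ContMDiffAt 𝓘(ℝ, Plane) 𝓘(ℝ, E →L[ℝ] F) ∞ (fun q => (β q).smulRight (η q)) q :=
  (isBoundedBilinearMap_smulRight (𝕜 := ℝ) (E := E)
    (F := F)).contDiff.contMDiff.contMDiffAt.comp q (hβ.prodMk_space hη)

theorem contMDiffAt_smul_space {F : Type*} [NormedAddCommGroup F] [NormedSpace ℝ F]
    {c : Q → ℝ} {f : Q → F} {q : Q} (hc : ContMDiffAt 𝓘(ℝ, Plane) 𝓘(ℝ, ℝ) ∞ c q)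
    (hf : ContMDiffAt 𝓘(ℝ, Plane) 𝓘(ℝ, F) ∞ f q) :
    ContMDiffAt 𝓘(ℝ, Plane) 𝓘(ℝ, F) ∞ (fun q => c q • f q) q :=
  contDiff_smul.contMDiff.contMDiffAt.comp q (hc.prodMk_space hf)

theorem contMDiffAt_add_space {F : Type*} [NormedAddCommGroup F] [NormedSpace ℝ F]
    {f f' : Q → F} {q : Q} (hf : ContMDiffAt 𝓘(ℝ, Plane) 𝓘(ℝ, F) ∞ f q)
    (hf' : ContMDiffAt 𝓘(ℝ, Plane) 𝓘(ℝ, F) ∞ f' q) :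
    ContMDiffAt 𝓘(ℝ, Plane) 𝓘(ℝ, F) ∞ (fun q => f q + f' q) q :=
  contDiff_add.contMDiff.contMDiffAt.comp q (hf.prodMk_space hf')

theorem metricCoeff_coordMetric (hφ : φ ∈ IsManifold.maximalAtlas 𝓘(ℝ, Plane) ∞ Q)
    (G₀ G₁ G₂ : Plane → ℝ) {q : Q} (hq : q ∈ φ.source) :
    metricCoeff φ (coordMetric φ G₀ G₁ G₂) 0 0 q = G₀ (φ q) ∧
    metricCoeff φ (coordMetric φ G₀ G₁ G₂) 0 1 q = G₁ (φ q) ∧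
    metricCoeff φ (coordMetric φ G₀ G₁ G₂) 1 1 q = G₂ (φ q) := by
  simp [metricCoeff, coordMetric_apply, coordForm_coordVector hφ hq]

/-- As for the covectors, the trivialization turns the coordinate forms into `coordFormIn`, and the
metric into a polynomial expression in these and the coefficients. -/
theorem contMDiffAt_coordMetric (hφ : φ ∈ IsManifold.maximalAtlas 𝓘(ℝ, Plane) ∞ Q)
    {G₀ G₁ G₂ : Plane → ℝ} {q : Q} (hq : q ∈ φ.source) (h₀ : ContDiffAt ℝ ∞ G₀ (φ q))
    (h₁ : ContDiffAt ℝ ∞ G₁ (φ q)) (h₂ : ContDiffAt ℝ ∞ G₂ (φ q)) :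
    ContMDiffAt 𝓘(ℝ, Plane) (𝓘(ℝ, Plane).prod 𝓘(ℝ, Plane →L[ℝ] Plane →L[ℝ] ℝ)) ∞
      (fun q => TotalSpace.mk' (Plane →L[ℝ] Plane →L[ℝ] ℝ)
        (E := fun q : Q =>
          TangentSpace 𝓘(ℝ, Plane) q →L[ℝ] TangentSpace 𝓘(ℝ, Plane) q →L[ℝ] ℝ) q
        (coordMetric φ G₀ G₁ G₂ q)) q := by
  refine (contMDiffAt_hom_bundle _).2 ⟨contMDiffAt_id, ?_⟩
  have hω : ∀ i, ContMDiffAt 𝓘(ℝ, Plane) 𝓘(ℝ, Plane →L[ℝ] ℝ) ∞ (coordFormIn φ q i) q :=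
    contMDiffAt_coordFormIn hφ hq (mem_chart_source _ _)
  have hG : ∀ {G : Plane → ℝ}, ContDiffAt ℝ ∞ G (φ q) →
      ContMDiffAt 𝓘(ℝ, Plane) 𝓘(ℝ, ℝ) ∞ (fun q => G (φ q)) q := fun h =>
    h.contMDiffAt.comp q (contMDiffAt_of_mem_maximalAtlas hφ hq)
  have hsm : ContMDiffAt 𝓘(ℝ, Plane) 𝓘(ℝ, Plane →L[ℝ] Plane →L[ℝ] ℝ) ∞
      (fun q' => G₀ (φ q') • (coordFormIn φ q 0 q').smulRight (coordFormIn φ q 0 q') +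
        G₁ (φ q') • ((coordFormIn φ q 0 q').smulRight (coordFormIn φ q 1 q') +
          (coordFormIn φ q 1 q').smulRight (coordFormIn φ q 0 q')) +
        G₂ (φ q') • (coordFormIn φ q 1 q').smulRight (coordFormIn φ q 1 q')) q := by
    exact contMDiffAt_add_space (contMDiffAt_add_space
      (contMDiffAt_smul_space (hG h₀) (contMDiffAt_smulRight (hω 0) (hω 0)))
      (contMDiffAt_smul_space (hG h₁) (contMDiffAt_add_space
        (contMDiffAt_smulRight (hω 0) (hω 1)) (contMDiffAt_smulRight (hω 1) (hω 0)))))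
      (contMDiffAt_smul_space (hG h₂) (contMDiffAt_smulRight (hω 1) (hω 1)))
  refine hsm.congr_of_eventuallyEq ?_
  filter_upwards [φ.open_source.mem_nhds hq,
    (chartAt Plane q).open_source.mem_nhds (mem_chart_source _ q)] with q' hq' hx
  ext u w
  refine (inCoordinates_apply_eq₂ (F₁ := Plane) (F₂ := Plane) (F₃ := ℝ)
      (E₁ := TangentSpace 𝓘(ℝ, Plane)) (E₂ := TangentSpace 𝓘(ℝ, Plane))
      (E₃ := fun _ : Q => ℝ) hx hx (mem_univ _)).trans ?_
  have h (i : Fin 2) (u : Plane) :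
      coordForm φ i q' ((trivializationAt Plane (TangentSpace 𝓘(ℝ, Plane)) q).symm q' u) =
        coordFormIn φ q i q' u := by
    rw [← Trivialization.symmL_apply (R := ℝ) _ hx]
    exact coordForm_symmL hφ hq' hx i u
  have h3 (c : ℝ) : (trivializationAt ℝ (fun _ : Q => ℝ) q).linearMapAt ℝ q' c = c := by simp
  refine (h3 _).trans ?_
  rw [coordMetric_apply]
  simp only [h]
  rfl

theorem isRiemannianMetricOn_coordMetric (hφ : φ ∈ IsManifold.maximalAtlas 𝓘(ℝ, Plane) ∞ Q)
    {G₀ G₁ G₂ : Plane → ℝ} (hU : U ⊆ φ.source)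
    (hG : ∀ q ∈ U, ContDiffAt ℝ ∞ G₀ (φ q) ∧ ContDiffAt ℝ ∞ G₁ (φ q) ∧ ContDiffAt ℝ ∞ G₂ (φ q))
    (hpos : ∀ q ∈ U, 0 < G₀ (φ q) ∧ 0 < G₀ (φ q) * G₂ (φ q) - G₁ (φ q) ^ 2) :
    IsRiemannianMetricOn (coordMetric φ G₀ G₁ G₂) U where
  symm q hq u w := by
    rw [coordMetric_apply, coordMetric_apply]; ring
  pos q hq u hu := by
    obtain ⟨h0, hD⟩ := hpos q hq
    rw [coordMetric_apply]
    have hne : coordForm φ 0 q u ≠ 0 ∨ coordForm φ 1 q u ≠ 0 := by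
      by_contra! h
      exact hu (tangent_eq_of_coordForm hφ (hU hq) fun i => by fin_cases i <;> simp [h.1, h.2])
    -- Multiplied by `G₀`, the form is `(G₀ s + G₁ t)² + (G₀ G₂ - G₁²) t²`.
    refine pos_of_mul_pos_right (a := G₀ (φ q)) ?_ h0.le
    by_cases h1 : coordForm φ 1 q u = 0
    · have := hne.resolve_right (by simp [h1])
      rw [h1]
      have : 0 < (G₀ (φ q) * coordForm φ 0 q u) ^ 2 := by positivity
      nlinarith
    · have : 0 < (G₀ (φ q) * G₂ (φ q) - G₁ (φ q) ^ 2) * coordForm φ 1 q u ^ 2 := by positivity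
      nlinarith [sq_nonneg (G₀ (φ q) * coordForm φ 0 q u + G₁ (φ q) * coordForm φ 1 q u)]
  smooth q hq := (contMDiffAt_coordMetric hφ (hU hq) (hG q hq).1 (hG q hq).2.1
    (hG q hq).2.2).contMDiffWithinAt

end MetricCoefficients

/-! ### Hamiltonian fields, vertical lifts and differentials in canonical coordinates. -/

section CanonicalCoordinates

variable {Q : Type*} [TopologicalSpace Q] [ChartedSpace Plane Q] [IsManifold 𝓘(ℝ, Plane) ∞ Q]
  {φ : OpenPartialHomeomorph Q Plane}
  {g : ∀ q : Q, TangentSpace 𝓘(ℝ, Plane) q →L[ℝ] TangentSpace 𝓘(ℝ, Plane) q →L[ℝ] ℝ} {U : Set Q}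

/-- The function `(q, p) ↦ ½ (a p₀² + 2 b p₀ p₁ + c p₁²) + w`. -/
def planeSimple (a b c w : Plane → ℝ) (z : Plane × Plane) : ℝ :=
  1 / 2 * (a z.1 * z.2 0 ^ 2 + 2 * b z.1 * z.2 0 * z.2 1 + c z.1 * z.2 1 ^ 2) + w z.1

theorem simpleFunction_cotangentCoordSymm (hφ : φ ∈ IsManifold.maximalAtlas 𝓘(ℝ, Plane) ∞ Q)
    (hg : IsRiemannianMetricOn g U) (w : Q → ℝ) {z : Plane × Plane} (hz : z.1 ∈ φ.target)
    (hU : φ.symm z.1 ∈ U) :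
    simpleFunction g w (cotangentCoordSymm φ z) =
      planeSimple (fun x => cometricCoeff φ g 0 0 (φ.symm x))
        (fun x => cometricCoeff φ g 0 1 (φ.symm x))
        (fun x => cometricCoeff φ g 1 1 (φ.symm x)) (fun x => w (φ.symm x)) z := by
  obtain ⟨-, h01, h10, -⟩ := cometricCoeff_eq hφ hg hU (φ.map_target hz) rfl
  have h : (∑ i, z.2 i • coordForm φ i (φ.symm z.1))
      (sharp g (φ.symm z.1) (∑ i, z.2 i • coordForm φ i (φ.symm z.1))) =
      cometricCoeff φ g 0 0 (φ.symm z.1) * z.2 0 ^ 2 +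
        2 * cometricCoeff φ g 0 1 (φ.symm z.1) * z.2 0 * z.2 1 +
        cometricCoeff φ g 1 1 (φ.symm z.1) * z.2 1 ^ 2 := by
    have h2 : cometricCoeff φ g 1 0 (φ.symm z.1) = cometricCoeff φ g 0 1 (φ.symm z.1) := by
      rw [h01, h10]
    unfold cometricCoeff at *
    simp only [Fin.sum_univ_two, map_add, map_smul, add_apply, smul_apply, smul_eq_mul]
    rw [h2]; ring
  exact congrArg (fun t => 1 / 2 * t + w (φ.symm z.1)) h

/-- The canonical Hamiltonian vector field of a function of `(q, p)`. -/
def planeField (K : Plane × Plane → ℝ) (z : Plane × Plane) : Plane × Plane :=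
  (WithLp.toLp 2 fun i => fderiv ℝ K z (0, EuclideanSpace.single i 1),
    WithLp.toLp 2 fun i => -fderiv ℝ K z (EuclideanSpace.single i 1, 0))

/-- The differential of the coordinates on the cotangent bundle. -/
def cotangentDeriv (φ : OpenPartialHomeomorph Q Plane) (z : Plane × Plane) :
    Plane × Plane →L[ℝ] Plane × (Plane →L[ℝ] ℝ) :=
  mfderiv 𝓘(ℝ, Plane × Plane) cotangentModel (cotangentCoordSymm φ) z

theorem hamiltonianField_cotangentCoordSymm
    (hφ : φ ∈ IsManifold.maximalAtlas 𝓘(ℝ, Plane) ∞ Q) (H : CotangentBundle Q → ℝ)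
    {z : Plane × Plane} (hz : z.1 ∈ φ.target) :
    hamiltonianField φ H (cotangentCoordSymm φ z) =
      cotangentDeriv φ z (planeField (fun z' => H (cotangentCoordSymm φ z')) z) := by
  change cotangentDeriv φ (cotangentCoord φ (cotangentCoordSymm φ z))
    (planeField _ (cotangentCoord φ (cotangentCoordSymm φ z))) = _
  rw [cotangentCoord_cotangentCoordSymm hφ hz]

theorem sum_smul_add_smul_sum {E : Type*} [AddCommGroup E] [Module ℝ E] (e : Fin 2 → E)
    (p b : Plane) (t : ℝ) :
    ∑ i, p i • e i + t • ∑ i, b i • e i = ∑ i, (p + t • b) i • e i := by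
  simp only [Finset.smul_sum, ← Finset.sum_add_distrib, smul_smul, ← add_smul]
  rfl

/-- In the induced coordinates the line `α + t β` is straight, with fixed base point and momentum
moving along the components of `β`. -/
theorem vlift_cotangentCoordSymm (hφ : φ ∈ IsManifold.maximalAtlas 𝓘(ℝ, Plane) ∞ Q)
    {z : Plane × Plane} (hz : z.1 ∈ φ.target)
    (β : TangentSpace 𝓘(ℝ, Plane) (cotangentCoordSymm φ z).proj →L[ℝ] ℝ) :
    vlift (cotangentCoordSymm φ z) β =
      cotangentDeriv φ z (0, WithLp.toLp 2 fun i => β (coordVector φ i (φ.symm z.1))) := by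
  set b : Plane := WithLp.toLp 2 fun i => β (coordVector φ i (φ.symm z.1)) with hb
  have hcurve : (fun t : ℝ => covector (cotangentCoordSymm φ z).proj
      ((cotangentCoordSymm φ z).snd + t • β)) =
      fun t : ℝ => cotangentCoordSymm φ (z + t • ((0, b) : Plane × Plane)) := by
    funext t
    have h1 : (z + t • ((0, b) : Plane × Plane)) = (z.1, z.2 + t • b) := by
      ext <;> simp
    rw [h1]
    have h2 : β = ∑ i, b i • coordForm φ i (φ.symm z.1) :=
      (sum_apply_coordVector hφ (φ.map_target hz) β).symm
    conv_lhs => rw [h2]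
    exact congrArg (covector (φ.symm z.1))
      (sum_smul_add_smul_sum (fun i => coordForm φ i (φ.symm z.1)) z.2 b t)
  have hline : HasFDerivAt (fun t : ℝ => z + t • ((0, b) : Plane × Plane))
      ((1 : ℝ →L[ℝ] ℝ).smulRight ((0, b) : Plane × Plane)) 0 :=
    ((1 : ℝ →L[ℝ] ℝ).smulRight ((0, b) : Plane × Plane)).hasFDerivAt.const_add z
  have hsm : HasMFDerivAt 𝓘(ℝ, Plane × Plane) cotangentModel (cotangentCoordSymm φ)
      (z + (0 : ℝ) • ((0, b) : Plane × Plane))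
      (mfderiv 𝓘(ℝ, Plane × Plane) cotangentModel (cotangentCoordSymm φ)
        (z + (0 : ℝ) • ((0, b) : Plane × Plane))) := by
    refine (ContMDiffAt.mdifferentiableAt ?_ (by simp : (∞ : WithTop ℕ∞) ≠ 0)).hasMFDerivAt
    exact contMDiffAt_cotangentCoordSymm hφ (by simpa using hz)
  have hcomp := (HasMFDerivAt.comp (0 : ℝ) hsm hline.hasMFDerivAt).mfderiv
  have hv : vlift (cotangentCoordSymm φ z) β = mfderiv 𝓘(ℝ, ℝ) cotangentModel
    (fun t : ℝ => covector (cotangentCoordSymm φ z).proj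
      ((cotangentCoordSymm φ z).snd + t • β)) 0 (1 : ℝ) := rfl
  rw [hv, hcurve]
  refine (DFunLike.congr_fun hcomp (1 : ℝ)).trans ?_
  change cotangentDeriv φ (z + (0 : ℝ) • ((0, b) : Plane × Plane))
    ((1 : ℝ) • ((0, b) : Plane × Plane)) = _
  rw [zero_smul, add_zero, one_smul]

/-- By the chain rule the derivative of `cotangentCoord` is a left inverse. This lets the vanishing
of the Hamiltonian field on the bundle be read off in the plane. -/
theorem cotangentDeriv_injective (hφ : φ ∈ IsManifold.maximalAtlas 𝓘(ℝ, Plane) ∞ Q)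
    {z : Plane × Plane} (hz : z.1 ∈ φ.target) : Function.Injective (cotangentDeriv φ z) := by
  have h1 := (contMDiffAt_cotangentCoordSymm hφ hz).mdifferentiableAt (by simp)
  have h2 : MDifferentiableAt cotangentModel 𝓘(ℝ, Plane × Plane) (cotangentCoord φ)
      (cotangentCoordSymm φ z) :=
    (contMDiffAt_cotangentCoord hφ (φ.map_target hz)).mdifferentiableAt (by simp)
  have h3 := h2.hasMFDerivAt.comp z h1.hasMFDerivAt
  have h4 : HasMFDerivAt 𝓘(ℝ, Plane × Plane) 𝓘(ℝ, Plane × Plane)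
      (cotangentCoord φ ∘ cotangentCoordSymm φ) z (ContinuousLinearMap.id ℝ (Plane × Plane)) := by
    refine (hasMFDerivAt_id z).congr_of_eventuallyEq ?_
    filter_upwards [continuousAt_fst.eventually (φ.open_target.mem_nhds hz)] with z' hz'
    exact cotangentCoord_cotangentCoordSymm hφ hz'
  have h5 := hasMFDerivAt_unique h3 h4
  intro X X' hX
  have e1 := DFunLike.congr_fun h5 X
  have e2 := DFunLike.congr_fun h5 X'
  refine e1.symm.trans (Eq.trans ?_ e2)
  exact congrArg (mfderiv cotangentModel 𝓘(ℝ, Plane × Plane) (cotangentCoord φ)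
      (cotangentCoordSymm φ z)) hX

theorem differential_cotangentDeriv (hφ : φ ∈ IsManifold.maximalAtlas 𝓘(ℝ, Plane) ∞ Q)
    {z : Plane × Plane} (hz : z.1 ∈ φ.target) {V : CotangentBundle Q → ℝ}
    (hV : MDifferentiableAt cotangentModel 𝓘(ℝ, ℝ) V (cotangentCoordSymm φ z))
    (X : Plane × Plane) :
    differential cotangentModel V (cotangentCoordSymm φ z) (cotangentDeriv φ z X) =
      fderiv ℝ (fun z' => V (cotangentCoordSymm φ z')) z X := by
  have h1 := (contMDiffAt_cotangentCoordSymm hφ hz).mdifferentiableAt (by simp)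
  have key : ∀ L : (Plane × (Plane →L[ℝ] ℝ)) →L[ℝ] ℝ,
      HasMFDerivAt cotangentModel 𝓘(ℝ, ℝ) V (cotangentCoordSymm φ z) L →
      L (cotangentDeriv φ z X) = fderiv ℝ (fun z' => V (cotangentCoordSymm φ z')) z X := by
    intro L hL
    have h3 : HasFDerivAt (fun z' => V (cotangentCoordSymm φ z')) (L ∘L cotangentDeriv φ z) z :=
      (hL.comp z h1.hasMFDerivAt).hasFDerivAt
    rw [h3.fderiv]
    rfl
  exact key _ hV.hasMFDerivAt

theorem contMDiffAt_of_coordinates (hφ : φ ∈ IsManifold.maximalAtlas 𝓘(ℝ, Plane) ∞ Q)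
    {z : Plane × Plane} (hz : z.1 ∈ φ.target) {V : CotangentBundle Q → ℝ}
    (hV : ContDiffAt ℝ ∞ (fun z' => V (cotangentCoordSymm φ z')) z) :
    ContMDiffAt cotangentModel 𝓘(ℝ, ℝ) ∞ V (cotangentCoordSymm φ z) := by
  have hsrc : (cotangentCoordSymm φ z).proj ∈ φ.source := φ.map_target hz
  have h1 := contMDiffAt_cotangentCoord hφ hsrc
  have h2 : ContMDiffAt 𝓘(ℝ, Plane × Plane) 𝓘(ℝ, ℝ) ∞ (fun z' => V (cotangentCoordSymm φ z'))
      (cotangentCoord φ (cotangentCoordSymm φ z)) := by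
    rw [cotangentCoord_cotangentCoordSymm hφ hz]
    exact hV.contMDiffAt
  refine (h2.comp _ h1).congr_of_eventuallyEq ?_
  have hcont : Continuous (fun α : CotangentBundle Q => α.proj) :=
    FiberBundle.continuous_proj _ _
  filter_upwards [hcont.continuousAt.eventually (φ.open_source.mem_nhds hsrc)] with α hα
  exact congrArg V (cotangentCoordSymm_cotangentCoord hφ hα).symm

end CanonicalCoordinates

/-! ### The controlled dynamics on the product of two planes. -/

section PlaneDynamics

variable {Q : Type*} [TopologicalSpace Q] [ChartedSpace Plane Q] [IsManifold 𝓘(ℝ, Plane) ∞ Q]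
  {φ : OpenPartialHomeomorph Q Plane}
  {g : ∀ q : Q, TangentSpace 𝓘(ℝ, Plane) q →L[ℝ] TangentSpace 𝓘(ℝ, Plane) q →L[ℝ] ℝ} {U : Set Q}

/-- Adaptedness makes `ξ` a multiple `c` of `dy`, and `c` is a unit, as pairing with `∂/∂y` shows.
Hence the actuation is exactly a force on the second momentum. -/
theorem mem_actuation_iff (hφ : φ ∈ IsManifold.maximalAtlas 𝓘(ℝ, Plane) ∞ Q)
    {ξ : ∀ q : Q, TangentSpace 𝓘(ℝ, Plane) q →L[ℝ] ℝ} (hξ : IsAdapted φ ξ)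
    {z : Plane × Plane} (hz : z.1 ∈ φ.target)
    (X : TangentSpace cotangentModel (cotangentCoordSymm φ z)) :
    X ∈ actuation ξ (cotangentCoordSymm φ z) ↔
      ∃ t : ℝ, X = cotangentDeriv φ z (0, EuclideanSpace.single 1 t) := by
  have hq : φ.symm z.1 ∈ φ.source := φ.map_target hz
  have hspan := hξ _ hq
  obtain ⟨c, hc⟩ := Submodule.mem_span_singleton.1
    (hspan ▸ Submodule.mem_span_singleton_self (ξ (φ.symm z.1)))
  obtain ⟨d, hd⟩ := Submodule.mem_span_singleton.1
    (hspan.symm ▸ Submodule.mem_span_singleton_self (coordForm φ 1 (φ.symm z.1)))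
  have hdc : d * c = 1 := by
    have h := congrArg (fun β => β (coordVector φ 1 (φ.symm z.1))) hd
    simpa [← hc, coordForm_coordVector hφ hq] using h
  have hv : vlift (cotangentCoordSymm φ z) (ξ (cotangentCoordSymm φ z).proj) =
      cotangentDeriv φ z (0, EuclideanSpace.single 1 c) := by
    rw [vlift_cotangentCoordSymm hφ hz]
    congr 2
    ext i
    change ξ (φ.symm z.1) (coordVector φ i (φ.symm z.1)) = _
    rw [← hc]
    fin_cases i <;> simp [coordForm_coordVector hφ hq]
  have hs (t s : ℝ) : t • cotangentDeriv φ z (0, EuclideanSpace.single 1 s) =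
      cotangentDeriv φ z (0, EuclideanSpace.single 1 (t * s)) := by
    rw [← map_smul]
    congr 1
    ext i
    · simp
    · fin_cases i <;> simp
  rw [actuation, Submodule.mem_span_singleton, hv]
  constructor
  · rintro ⟨t, rfl⟩
    exact ⟨t * c, hs t c⟩
  · rintro ⟨t, rfl⟩
    refine ⟨t * d, (hs (t * d) c).trans ?_⟩
    rw [mul_assoc, hdc, mul_one]

theorem clm_plane_apply (A : Plane →L[ℝ] ℝ) (u : Plane) :
    A u = u 0 * A (EuclideanSpace.single 0 1) + u 1 * A (EuclideanSpace.single 1 1) := by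
  have : u = u 0 • EuclideanSpace.single 0 (1 : ℝ) + u 1 • EuclideanSpace.single 1 (1 : ℝ) := by
    ext i
    fin_cases i <;> simp
  conv_lhs => rw [this]
  simp

theorem fderiv_planeSimple {a b c w : Plane → ℝ} {z : Plane × Plane}
    (ha : DifferentiableAt ℝ a z.1) (hb : DifferentiableAt ℝ b z.1)
    (hc : DifferentiableAt ℝ c z.1) (hw : DifferentiableAt ℝ w z.1) (X : Plane × Plane) :
    fderiv ℝ (planeSimple a b c w) z X =
      1 / 2 * (fderiv ℝ a z.1 X.1 * z.2 0 ^ 2 + 2 * fderiv ℝ b z.1 X.1 * z.2 0 * z.2 1 +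
        fderiv ℝ c z.1 X.1 * z.2 1 ^ 2) + fderiv ℝ w z.1 X.1 +
        (a z.1 * z.2 0 + b z.1 * z.2 1) * X.2 0 + (b z.1 * z.2 0 + c z.1 * z.2 1) * X.2 1 := by
  have hp (i : Fin 2) : HasFDerivAt (fun z : Plane × Plane => z.2 i)
      ((EuclideanSpace.proj i : Plane →L[ℝ] ℝ) ∘L ContinuousLinearMap.snd ℝ Plane Plane) z :=
    ((EuclideanSpace.proj i : Plane →L[ℝ] ℝ) ∘L ContinuousLinearMap.snd ℝ Plane Plane).hasFDerivAt
  have hf {f : Plane → ℝ} (h : DifferentiableAt ℝ f z.1) :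
      HasFDerivAt (fun z : Plane × Plane => f z.1)
        (fderiv ℝ f z.1 ∘L ContinuousLinearMap.fst ℝ Plane Plane) z :=
    h.hasFDerivAt.comp z hasFDerivAt_fst
  have h := ((((hf ha).mul ((hp 0).pow 2)).add ((((hf hb).const_mul 2).mul (hp 0)).mul
    (hp 1))).add ((hf hc).mul ((hp 1).pow 2))).const_mul (1 / 2 : ℝ) |>.add (hf hw)
  have h' : HasFDerivAt (planeSimple a b c w) _ z := h
  rw [h'.fderiv]
  simp only [add_apply, smul_apply, smul_eq_mul, ContinuousLinearMap.comp_apply,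
    ContinuousLinearMap.coe_fst', ContinuousLinearMap.coe_snd', PiLp.proj_apply, nsmul_eq_mul]
  norm_num
  ring

theorem ContDiffAt.planeSimple {a b c w : Plane → ℝ} {z : Plane × Plane}
    (ha : ContDiffAt ℝ ∞ a z.1) (hb : ContDiffAt ℝ ∞ b z.1)
    (hc : ContDiffAt ℝ ∞ c z.1) (hw : ContDiffAt ℝ ∞ w z.1) :
    ContDiffAt ℝ ∞ (planeSimple a b c w) z := by
  have hp (i : Fin 2) : ContDiffAt ℝ ∞ (fun z : Plane × Plane => z.2 i) z := by fun_prop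
  have hf {f : Plane → ℝ} (h : ContDiffAt ℝ ∞ f z.1) :
      ContDiffAt ℝ ∞ (fun z : Plane × Plane => f z.1) z := h.comp z contDiffAt_fst
  exact (contDiffAt_const.mul ((((hf ha).mul ((hp 0).pow 2)).add
    (((contDiffAt_const.mul (hf hb)).mul (hp 0)).mul (hp 1))).add
      ((hf hc).mul ((hp 1).pow 2)))).add (hf hw)

/-- The derivative of `½ (f₀ p₀² + 2 f₁ p₀ p₁ + f₂ p₁²) + v` along the Hamiltonian vector field of
`½ (a p₀² + 2 b p₀ p₁ + c p₁²) + h`, controlled by a force in the direction of `p₁`. -/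
theorem fderiv_planeSimple_planeField {a b c h f₀ f₁ f₂ v : Plane → ℝ} {z : Plane × Plane}
    (ha : DifferentiableAt ℝ a z.1) (hb : DifferentiableAt ℝ b z.1)
    (hc : DifferentiableAt ℝ c z.1) (hh : DifferentiableAt ℝ h z.1)
    (h₀ : DifferentiableAt ℝ f₀ z.1) (h₁ : DifferentiableAt ℝ f₁ z.1)
    (h₂ : DifferentiableAt ℝ f₂ z.1) (hv : DifferentiableAt ℝ v z.1) (t : ℝ)
    {k : Plane} (hk₀ : k 0 = a z.1 * z.2 0 + b z.1 * z.2 1)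
    (hk₁ : k 1 = b z.1 * z.2 0 + c z.1 * z.2 1) {e₀ e₁ : Plane}
    (he₀ : e₀ = EuclideanSpace.single 0 1) (he₁ : e₁ = EuclideanSpace.single 1 1) :
    fderiv ℝ (planeSimple f₀ f₁ f₂ v) z
      (planeField (planeSimple a b c h) z + (0, EuclideanSpace.single 1 t)) =
      1 / 2 * (fderiv ℝ f₀ z.1 k * z.2 0 ^ 2 + 2 * fderiv ℝ f₁ z.1 k * z.2 0 * z.2 1 +
        fderiv ℝ f₂ z.1 k * z.2 1 ^ 2) + fderiv ℝ v z.1 k -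
        (f₀ z.1 * z.2 0 + f₁ z.1 * z.2 1) * (1 / 2 * (fderiv ℝ a z.1 e₀ * z.2 0 ^ 2 +
          2 * fderiv ℝ b z.1 e₀ * z.2 0 * z.2 1 + fderiv ℝ c z.1 e₀ * z.2 1 ^ 2) +
          fderiv ℝ h z.1 e₀) +
        (f₁ z.1 * z.2 0 + f₂ z.1 * z.2 1) * (t - (1 / 2 * (fderiv ℝ a z.1 e₁ * z.2 0 ^ 2 +
          2 * fderiv ℝ b z.1 e₁ * z.2 0 * z.2 1 + fderiv ℝ c z.1 e₁ * z.2 1 ^ 2) +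
          fderiv ℝ h z.1 e₁)) := by
  have hfield : planeField (planeSimple a b c h) z + (0, EuclideanSpace.single 1 t) =
      (k, WithLp.toLp 2 ![-(1 / 2 * (fderiv ℝ a z.1 e₀ * z.2 0 ^ 2 +
          2 * fderiv ℝ b z.1 e₀ * z.2 0 * z.2 1 + fderiv ℝ c z.1 e₀ * z.2 1 ^ 2) +
          fderiv ℝ h z.1 e₀), t - (1 / 2 * (fderiv ℝ a z.1 e₁ * z.2 0 ^ 2 +
          2 * fderiv ℝ b z.1 e₁ * z.2 0 * z.2 1 + fderiv ℝ c z.1 e₁ * z.2 1 ^ 2) +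
          fderiv ℝ h z.1 e₁)]) := by
    refine Prod.ext ?_ ?_ <;> ext i <;> fin_cases i <;>
      simp [planeField, fderiv_planeSimple ha hb hc hh, hk₀, hk₁, he₀, he₁]
    ring
  rw [hfield, fderiv_planeSimple h₀ h₁ h₂ hv]
  simp only [Matrix.cons_val_zero, Matrix.cons_val_one]
  ring

end PlaneDynamics

/-! ### Local expressions of metrics and simple functions. -/

section LocalExpressions

variable {Q : Type*} [TopologicalSpace Q] [ChartedSpace Plane Q] [IsManifold 𝓘(ℝ, Plane) ∞ Q]
  {φ : OpenPartialHomeomorph Q Plane}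
  {g g' : ∀ q : Q, TangentSpace 𝓘(ℝ, Plane) q →L[ℝ] TangentSpace 𝓘(ℝ, Plane) q →L[ℝ] ℝ}
  {U U' : Set Q}

/-- The local expression of the coefficients of the metric. -/
def localMetric (φ : OpenPartialHomeomorph Q Plane)
    (g : ∀ q : Q, TangentSpace 𝓘(ℝ, Plane) q →L[ℝ] TangentSpace 𝓘(ℝ, Plane) q →L[ℝ] ℝ)
    (i j : Fin 2) (x : Plane) : ℝ :=
  metricCoeff φ g i j (φ.symm x)

/-- The local expression of the coefficients of the inverse of the metric. -/
def localCometric (φ : OpenPartialHomeomorph Q Plane)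
    (g : ∀ q : Q, TangentSpace 𝓘(ℝ, Plane) q →L[ℝ] TangentSpace 𝓘(ℝ, Plane) q →L[ℝ] ℝ)
    (i j : Fin 2) (x : Plane) : ℝ :=
  cometricCoeff φ g i j (φ.symm x)

theorem contDiffAt_local (hφ : φ ∈ IsManifold.maximalAtlas 𝓘(ℝ, Plane) ∞ Q) {x : Plane}
    (hx : x ∈ φ.target) {f : Q → ℝ} (hf : ContMDiffAt 𝓘(ℝ, Plane) 𝓘(ℝ, ℝ) ∞ f (φ.symm x)) :
    ContDiffAt ℝ ∞ (fun x => f (φ.symm x)) x :=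
  (hf.comp x (contMDiffAt_symm_of_mem_maximalAtlas hφ hx)).contDiffAt

theorem contDiffAt_localMetric (hφ : φ ∈ IsManifold.maximalAtlas 𝓘(ℝ, Plane) ∞ Q)
    (hg : IsRiemannianMetricOn g U) (hU : IsOpen U) {x : Plane} (hx : x ∈ φ.target)
    (hxU : φ.symm x ∈ U) (i j : Fin 2) : ContDiffAt ℝ ∞ (localMetric φ g i j) x :=
  contDiffAt_local hφ hx (contMDiffAt_metricCoeff hφ hg hU hxU (φ.map_target hx) i j)

theorem eventually_mem_target_of_open (hU : IsOpen U) {x : Plane} (hx : x ∈ φ.target)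
    (hxU : φ.symm x ∈ U) : ∀ᶠ y in 𝓝 x, y ∈ φ.target ∧ φ.symm y ∈ U :=
  (φ.open_target.eventually_mem hx).and
    ((φ.continuousAt_symm hx).eventually (hU.mem_nhds hxU))

theorem localMetric_det_pos (hφ : φ ∈ IsManifold.maximalAtlas 𝓘(ℝ, Plane) ∞ Q)
    (hg : IsRiemannianMetricOn g U) {x : Plane} (hx : x ∈ φ.target) (hxU : φ.symm x ∈ U) :
    0 < localMetric φ g 0 0 x * localMetric φ g 1 1 x - localMetric φ g 0 1 x ^ 2 :=
  metricCoeff_det_pos hφ hg hxU (φ.map_target hx)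

theorem localMetric_zero_zero_pos (hφ : φ ∈ IsManifold.maximalAtlas 𝓘(ℝ, Plane) ∞ Q)
    (hg : IsRiemannianMetricOn g U) {x : Plane} (hx : x ∈ φ.target) (hxU : φ.symm x ∈ U) :
    0 < localMetric φ g 0 0 x :=
  metricCoeff_zero_zero_pos hφ hg hxU (φ.map_target hx)

theorem localCometric_eq (hφ : φ ∈ IsManifold.maximalAtlas 𝓘(ℝ, Plane) ∞ Q)
    (hg : IsRiemannianMetricOn g U) {x : Plane} (hx : x ∈ φ.target) (hxU : φ.symm x ∈ U)
    {D : ℝ} (hD : D = localMetric φ g 0 0 x * localMetric φ g 1 1 x - localMetric φ g 0 1 x ^ 2) :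
    localCometric φ g 0 0 x = localMetric φ g 1 1 x / D ∧
    localCometric φ g 0 1 x = -localMetric φ g 0 1 x / D ∧
    localCometric φ g 1 0 x = -localMetric φ g 0 1 x / D ∧
    localCometric φ g 1 1 x = localMetric φ g 0 0 x / D :=
  cometricCoeff_eq hφ hg hxU (φ.map_target hx) hD

theorem contDiffAt_localCometric (hφ : φ ∈ IsManifold.maximalAtlas 𝓘(ℝ, Plane) ∞ Q)
    (hg : IsRiemannianMetricOn g U) (hU : IsOpen U) {x : Plane} (hx : x ∈ φ.target)
    (hxU : φ.symm x ∈ U) (i j : Fin 2) : ContDiffAt ℝ ∞ (localCometric φ g i j) x := by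
  have hM := contDiffAt_localMetric hφ hg hU hx hxU
  have hD := ((hM 0 0).mul (hM 1 1)).sub ((hM 0 1).pow 2)
  have hD0 := (localMetric_det_pos hφ hg hx hxU).ne'
  have hev := eventually_mem_target_of_open hU hx hxU
  fin_cases i <;> fin_cases j
  · refine ((hM 1 1).div hD hD0).congr_of_eventuallyEq ?_
    filter_upwards [hev] with y hy using (localCometric_eq hφ hg hy.1 hy.2 rfl).1
  · refine ((hM 0 1).neg.div hD hD0).congr_of_eventuallyEq ?_
    filter_upwards [hev] with y hy using (localCometric_eq hφ hg hy.1 hy.2 rfl).2.1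
  · refine ((hM 0 1).neg.div hD hD0).congr_of_eventuallyEq ?_
    filter_upwards [hev] with y hy using (localCometric_eq hφ hg hy.1 hy.2 rfl).2.2.1
  · refine ((hM 0 0).div hD hD0).congr_of_eventuallyEq ?_
    filter_upwards [hev] with y hy using (localCometric_eq hφ hg hy.1 hy.2 rfl).2.2.2

/-- The local expression of a simple function on the cotangent bundle. -/
def localSimple (φ : OpenPartialHomeomorph Q Plane)
    (g : ∀ q : Q, TangentSpace 𝓘(ℝ, Plane) q →L[ℝ] TangentSpace 𝓘(ℝ, Plane) q →L[ℝ] ℝ)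
    (w : Q → ℝ) : Plane × Plane → ℝ :=
  planeSimple (localCometric φ g 0 0) (localCometric φ g 0 1) (localCometric φ g 1 1)
    (fun x => w (φ.symm x))

theorem simpleFunction_eventuallyEq (hφ : φ ∈ IsManifold.maximalAtlas 𝓘(ℝ, Plane) ∞ Q)
    (hg : IsRiemannianMetricOn g U) (hU : IsOpen U) (w : Q → ℝ) {z : Plane × Plane}
    (hz : z.1 ∈ φ.target) (hzU : φ.symm z.1 ∈ U) :
    (fun z' => simpleFunction g w (cotangentCoordSymm φ z')) =ᶠ[𝓝 z] localSimple φ g w := by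
  filter_upwards [continuousAt_fst.eventually (eventually_mem_target_of_open hU hz hzU)]
    with z' hz'
  exact simpleFunction_cotangentCoordSymm hφ hg w hz'.1 hz'.2

theorem contDiffAt_localSimple (hφ : φ ∈ IsManifold.maximalAtlas 𝓘(ℝ, Plane) ∞ Q)
    (hg : IsRiemannianMetricOn g U) (hU : IsOpen U) {w : Q → ℝ}
    (hw : ContMDiffOn 𝓘(ℝ, Plane) 𝓘(ℝ, ℝ) ∞ w U) {z : Plane × Plane}
    (hz : z.1 ∈ φ.target) (hzU : φ.symm z.1 ∈ U) : ContDiffAt ℝ ∞ (localSimple φ g w) z :=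
  have hC := contDiffAt_localCometric hφ hg hU hz hzU
  ContDiffAt.planeSimple (hC 0 0) (hC 0 1) (hC 1 1)
    (contDiffAt_local hφ hz ((hw _ hzU).contMDiffAt (hU.mem_nhds hzU)))

theorem contMDiffAt_simpleFunction (hφ : φ ∈ IsManifold.maximalAtlas 𝓘(ℝ, Plane) ∞ Q)
    (hg : IsRiemannianMetricOn g U) (hU : IsOpen U) {w : Q → ℝ}
    (hw : ContMDiffOn 𝓘(ℝ, Plane) 𝓘(ℝ, ℝ) ∞ w U) {z : Plane × Plane}
    (hz : z.1 ∈ φ.target) (hzU : φ.symm z.1 ∈ U) :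
    ContMDiffAt cotangentModel 𝓘(ℝ, ℝ) ∞ (simpleFunction g w) (cotangentCoordSymm φ z) :=
  contMDiffAt_of_coordinates hφ hz
    ((contDiffAt_localSimple hφ hg hU hw hz hzU).congr_of_eventuallyEq
      (simpleFunction_eventuallyEq hφ hg hU w hz hzU))

theorem planeField_congr {K K' : Plane × Plane → ℝ} {z : Plane × Plane} (h : K =ᶠ[𝓝 z] K') :
    planeField K z = planeField K' z := by
  simp only [planeField, h.fderiv_eq]

theorem hamiltonianField_simpleFunction (hφ : φ ∈ IsManifold.maximalAtlas 𝓘(ℝ, Plane) ∞ Q)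
    (hg : IsRiemannianMetricOn g U) (hU : IsOpen U) (w : Q → ℝ) {z : Plane × Plane}
    (hz : z.1 ∈ φ.target) (hzU : φ.symm z.1 ∈ U) :
    hamiltonianField φ (simpleFunction g w) (cotangentCoordSymm φ z) =
      cotangentDeriv φ z (planeField (localSimple φ g w) z) := by
  rw [hamiltonianField_cotangentCoordSymm hφ _ hz,
    planeField_congr (simpleFunction_eventuallyEq hφ hg hU w hz hzU)]

/-- The derivative of a simple function along a controlled simple Hamiltonian vector field. -/
theorem differential_simpleFunction (hφ : φ ∈ IsManifold.maximalAtlas 𝓘(ℝ, Plane) ∞ Q)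
    (hg : IsRiemannianMetricOn g U) (hU : IsOpen U) (w : Q → ℝ)
    (hg' : IsRiemannianMetricOn g' U') (hU' : IsOpen U') {v : Q → ℝ}
    (hv : ContMDiffOn 𝓘(ℝ, Plane) 𝓘(ℝ, ℝ) ∞ v U') {z : Plane × Plane}
    (hz : z.1 ∈ φ.target) (hzU : φ.symm z.1 ∈ U) (hzU' : φ.symm z.1 ∈ U') (X : Plane × Plane)
    {Y : TangentSpace cotangentModel (cotangentCoordSymm φ z)} (hY : Y = cotangentDeriv φ z X) :
    differential cotangentModel (simpleFunction g' v) (cotangentCoordSymm φ z)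
      (hamiltonianField φ (simpleFunction g w) (cotangentCoordSymm φ z) + Y) =
      fderiv ℝ (localSimple φ g' v) z (planeField (localSimple φ g w) z + X) := by
  rw [hamiltonianField_simpleFunction hφ hg hU w hz hzU, hY]
  have h := differential_cotangentDeriv hφ hz ((contMDiffAt_simpleFunction hφ hg' hU' hv hz
    hzU').mdifferentiableAt (by simp)) (planeField (localSimple φ g w) z + X)
  rw [(simpleFunction_eventuallyEq hφ hg' hU' v hz hzU').fderiv_eq, map_add] at h
  exact h

end LocalExpressions

/-! ### Necessity: the potential matching condition and its Hessian. -/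

section Necessity

/-- The expression vanishes at `0`, which is therefore a local maximum, and its derivative there is
`A`. -/
theorem eq_zero_of_cubic_nonpos {C A : ℝ} (h : ∀ᶠ s : ℝ in 𝓝 0, s * (s ^ 2 * C + A) ≤ 0) :
    A = 0 := by
  have h1 : HasDerivAt (fun s : ℝ => s * (s ^ 2 * C + A)) A 0 := by
    have := (hasDerivAt_id (0 : ℝ)).mul
      ((((hasDerivAt_id (0 : ℝ)).pow 2).mul_const C).add_const A)
    refine this.congr_deriv ?_
    simp
  refine IsLocalMax.hasDerivAt_eq_zero ?_ h1
  filter_upwards [h] with s hs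
  simpa using hs

theorem fderiv_fderiv_comm {f : Plane → ℝ} {x : Plane} (hf : ContDiffAt ℝ ∞ f x) (u w : Plane) :
    fderiv ℝ (fderiv ℝ f) x u w = fderiv ℝ (fderiv ℝ f) x w u :=
  (hf.isSymmSndFDerivAt (by simpa using ENat.LEInfty.out)).eq u w

/-- Where the derivative of `v` vanishes, differentiating `∂ᵤ v = ∂ₑ h` gives the second
derivatives. -/
theorem hessian_apply_of_fderiv_eq {v h : Plane → ℝ} {u : Plane → Plane} {x e : Plane}
    (hv : ContDiffAt ℝ ∞ v x) (hh : ContDiffAt ℝ ∞ h x) (hu : DifferentiableAt ℝ u x)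
    (hv0 : fderiv ℝ v x = 0) (heq : ∀ᶠ y in 𝓝 x, fderiv ℝ v y (u y) = fderiv ℝ h y e)
    (w : Plane) :
    fderiv ℝ (fderiv ℝ v) x w (u x) = fderiv ℝ (fderiv ℝ h) x w e := by
  have hdv : HasFDerivAt (fderiv ℝ v) (fderiv ℝ (fderiv ℝ v) x) x :=
    ((hv.fderiv_right (m := ∞) (by simp)).differentiableAt (by simp)).hasFDerivAt
  have hdh : HasFDerivAt (fderiv ℝ h) (fderiv ℝ (fderiv ℝ h) x) x :=
    ((hh.fderiv_right (m := ∞) (by simp)).differentiableAt (by simp)).hasFDerivAt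
  have h1 := hdv.clm_apply hu.hasFDerivAt
  have h2 := hdh.clm_apply (hasFDerivAt_const e x)
  have h3 := (h2.congr_of_eventuallyEq heq).unique h1
  have h4 := DFunLike.congr_fun h3 w
  simpa [hv0] using h4.symm

variable {Q : Type*} [TopologicalSpace Q] [ChartedSpace Plane Q] [IsManifold 𝓘(ℝ, Plane) ∞ Q]
  {φ : OpenPartialHomeomorph Q Plane}
  {g g' : ∀ q : Q, TangentSpace 𝓘(ℝ, Plane) q →L[ℝ] TangentSpace 𝓘(ℝ, Plane) q →L[ℝ] ℝ}
  {U U' : Set Q}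

theorem isRiemannianMetricOn_inner
    (ρ : ContMDiffRiemannianMetric 𝓘(ℝ, Plane) ∞ Plane
      (fun q : Q => TangentSpace 𝓘(ℝ, Plane) q)) : IsRiemannianMetricOn ρ.inner univ where
  symm q _ := ρ.symm q
  pos q _ := ρ.pos q
  smooth := ρ.contMDiff.contMDiffOn

theorem cotangentCoordSymm_zero (x : Plane) :
    cotangentCoordSymm φ (x, 0) = covector (φ.symm x) 0 := by
  simp [cotangentCoordSymm]

/-- The matching condition between the potentials, on the directions without actuation. -/
theorem potential_matching (hφ : φ ∈ IsManifold.maximalAtlas 𝓘(ℝ, Plane) ∞ Q)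
    (hg : IsRiemannianMetricOn g univ) {h : Q → ℝ} (hh : ContMDiff 𝓘(ℝ, Plane) 𝓘(ℝ, ℝ) ∞ h)
    {ξ : ∀ q : Q, TangentSpace 𝓘(ℝ, Plane) q →L[ℝ] ℝ} (hξ : IsAdapted φ ξ)
    {O : Set (CotangentBundle Q)} {Y : ∀ α : CotangentBundle Q, TangentSpace cotangentModel α}
    {v : Q → ℝ} (hU' : IsOpen U') (hO : IsOpen O) (hOU : ∀ α ∈ O, α.proj ∈ U')
    (hY : ∀ α ∈ O, Y α ∈ actuation ξ α) (hg' : IsRiemannianMetricOn g' U')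
    (hv : ContMDiffOn 𝓘(ℝ, Plane) 𝓘(ℝ, ℝ) ∞ v U')
    (hdV : ∀ α ∈ O, differential cotangentModel (simpleFunction g' v) α
      (hamiltonianField φ (simpleFunction g h) α + Y α) ≤ 0)
    {x : Plane} (hx : x ∈ φ.target) (hxO : covector (φ.symm x) 0 ∈ O) {k : Plane}
    (hk₀ : k 0 = localCometric φ g 0 0 x * localMetric φ g' 0 0 x +
      localCometric φ g 0 1 x * localMetric φ g' 0 1 x)
    (hk₁ : k 1 = localCometric φ g 0 1 x * localMetric φ g' 0 0 x +
      localCometric φ g 1 1 x * localMetric φ g' 0 1 x) :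
    fderiv ℝ (fun x => v (φ.symm x)) x k =
      fderiv ℝ (fun x => h (φ.symm x)) x (EuclideanSpace.single 0 1) := by
  have hxU' : φ.symm x ∈ U' := hOU _ hxO
  have hA := fun i j => (contDiffAt_localCometric hφ hg isOpen_univ hx (mem_univ _) i
    j).differentiableAt (by simp)
  have hF := fun i j => (contDiffAt_localCometric hφ hg' hU' hx hxU' i j).differentiableAt (by simp)
  have hh' := (contDiffAt_local hφ hx (hh _)).differentiableAt (by simp)
  have hv' := (contDiffAt_local hφ hx ((hv _ hxU').contMDiffAt
    (hU'.mem_nhds hxU'))).differentiableAt (by simp)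
  have hD := localMetric_det_pos hφ hg' hx hxU'
  obtain ⟨e00, e01, -, e11⟩ := localCometric_eq hφ hg' hx hxU' rfl
  -- The covector `w = (w₀, w₁)` is `∂/∂x` lowered by `g'`. Raising it again gives `hF0` and `hF1`,
  -- so `∂V/∂p₁ = 0` along `s • w` and the unknown force `t` drops out.
  set w₀ := localMetric φ g' 0 0 x with hw₀
  set w₁ := localMetric φ g' 0 1 x with hw₁
  set w : Plane := WithLp.toLp 2 ![w₀, w₁] with hw
  have hF0 : localCometric φ g' 0 0 x * w₀ + localCometric φ g' 0 1 x * w₁ = 1 := by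
    rw [e00, e01, div_mul_eq_mul_div, div_mul_eq_mul_div, ← add_div, div_eq_one_iff_eq hD.ne']
    ring
  have hF1 : localCometric φ g' 0 1 x * w₀ + localCometric φ g' 1 1 x * w₁ = 0 := by
    rw [e11, e01]; field_simp; ring
  have hmem : ∀ᶠ s : ℝ in 𝓝 0, cotangentCoordSymm φ (x, s • w) ∈ O := by
    have hc : ContinuousAt (fun s : ℝ => cotangentCoordSymm φ (x, s • w)) 0 :=
      ContinuousAt.comp (g := cotangentCoordSymm φ) (f := fun s : ℝ => (x, s • w))
        (contMDiffAt_cotangentCoordSymm hφ hx).continuousAt (by fun_prop)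
    refine hc.eventually (hO.mem_nhds ?_)
    simpa [cotangentCoordSymm_zero] using hxO
  rw [← sub_eq_zero]
  -- `C` collects the terms cubic in the momentum, which come from derivatives of the two cometrics;
  -- only the linear coefficient, from the potentials, is needed.
  refine eq_zero_of_cubic_nonpos (C := 1 / 2 * (fderiv ℝ (localCometric φ g' 0 0) x k * w₀ ^ 2 +
      2 * fderiv ℝ (localCometric φ g' 0 1) x k * w₀ * w₁ +
      fderiv ℝ (localCometric φ g' 1 1) x k * w₁ ^ 2) -
    1 / 2 * (fderiv ℝ (localCometric φ g 0 0) x (EuclideanSpace.single 0 1) * w₀ ^ 2 +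
      2 * fderiv ℝ (localCometric φ g 0 1) x (EuclideanSpace.single 0 1) * w₀ * w₁ +
      fderiv ℝ (localCometric φ g 1 1) x (EuclideanSpace.single 0 1) * w₁ ^ 2)) ?_
  filter_upwards [hmem] with s hs
  have h1 := hdV _ hs
  obtain ⟨t, ht⟩ := (mem_actuation_iff hφ hξ hx _).1 (hY _ hs)
  rw [differential_simpleFunction hφ hg isOpen_univ h hg' hU' hv hx (mem_univ _) hxU' _ ht,
    localSimple, localSimple, fderiv_planeSimple_planeField (k := s • k) (hA 0 0) (hA 0 1) (hA 1 1)
    hh' (hF 0 0) (hF 0 1) (hF 1 1) hv' t (by simp [hk₀, w]; ring) (by simp [hk₁, w]; ring)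
    rfl rfl] at h1
  refine le_trans (le_of_eq ?_) h1
  simp only [w, map_smul, smul_eq_mul, PiLp.smul_apply, Matrix.cons_val_zero, Matrix.cons_val_one]
  set B₀ := 1 / 2 * (fderiv ℝ (localCometric φ g 0 0) x (EuclideanSpace.single 0 1) * w₀ ^ 2 +
      2 * fderiv ℝ (localCometric φ g 0 1) x (EuclideanSpace.single 0 1) * w₀ * w₁ +
      fderiv ℝ (localCometric φ g 1 1) x (EuclideanSpace.single 0 1) * w₁ ^ 2) with hB₀
  set B₁ := 1 / 2 * (fderiv ℝ (localCometric φ g 0 0) x (EuclideanSpace.single 1 1) * w₀ ^ 2 +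
      2 * fderiv ℝ (localCometric φ g 0 1) x (EuclideanSpace.single 1 1) * w₀ * w₁ +
      fderiv ℝ (localCometric φ g 1 1) x (EuclideanSpace.single 1 1) * w₁ ^ 2) with hB₁
  linear_combination
    s * (s ^ 2 * B₀ + fderiv ℝ (fun x => h (φ.symm x)) x (EuclideanSpace.single 0 1)) * hF0 -
    s * (t - (s ^ 2 * B₁ + fderiv ℝ (fun x => h (φ.symm x)) x (EuclideanSpace.single 1 1))) * hF1

/-- Only the Lyapunov inequality near the zero section and the positive Hessian of `v` enter. The
assumption `h0` is the failure of the first alternative, and it reduces `Hess v(k, k) > 0` to the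
sign of `h_xx`. -/
theorem pos_of_stabilizable (hφ : φ ∈ IsManifold.maximalAtlas 𝓘(ℝ, Plane) ∞ Q)
    (hg : IsRiemannianMetricOn g univ) {h : Q → ℝ} (hh : ContMDiff 𝓘(ℝ, Plane) 𝓘(ℝ, ℝ) ∞ h)
    {ξ : ∀ q : Q, TangentSpace 𝓘(ℝ, Plane) q →L[ℝ] ℝ} (hξ : IsAdapted φ ξ)
    {q₀ : Q} (hq₀ : q₀ ∈ φ.source)
    (hstab : StabilizableBySimpleLyapunov φ (simpleFunction g h) ξ q₀)
    (h0 : cometricCoeff φ g 0 1 q₀ * secondPartial φ h 0 0 q₀ +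
          cometricCoeff φ g 1 1 q₀ * secondPartial φ h 0 1 q₀ = 0) :
    0 < secondPartial φ h 0 0 q₀ := by
  obtain ⟨U', O, Y, g', v, hU', hqU', hUs, hO, h0O, hOU, -, hY, -, hg', hv, hV, hhess⟩ := hstab
  set x₀ := φ q₀ with hx₀
  have hx : x₀ ∈ φ.target := φ.map_source hq₀
  have hsymm : φ.symm x₀ = q₀ := φ.left_inv hq₀
  have hxU' : φ.symm x₀ ∈ U' := by rwa [hsymm]
  set vl : Plane → ℝ := fun x => v (φ.symm x) with hvl
  set hl : Plane → ℝ := fun x => h (φ.symm x) with hhl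
  have hvs : ContDiffAt ℝ ∞ vl x₀ :=
    contDiffAt_local hφ hx ((hv _ hxU').contMDiffAt (hU'.mem_nhds hxU'))
  have hhs : ContDiffAt ℝ ∞ hl x₀ := contDiffAt_local hφ hx (hh _)
  have hA := contDiffAt_localCometric hφ hg isOpen_univ hx (mem_univ _)
  have hM := contDiffAt_localMetric hφ hg' hU' hx hxU'
  have hev : ∀ᶠ x in 𝓝 x₀, x ∈ φ.target ∧ covector (φ.symm x) 0 ∈ O := by
    refine (φ.open_target.eventually_mem hx).and ?_
    have hc : ContinuousAt (fun x : Plane => cotangentCoordSymm φ (x, 0)) x₀ :=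
      ContinuousAt.comp (g := cotangentCoordSymm φ) (f := fun x : Plane => (x, (0 : Plane)))
        (contMDiffAt_cotangentCoordSymm hφ hx).continuousAt (by fun_prop)
    simp only [cotangentCoordSymm_zero] at hc
    refine hc.eventually (hO.mem_nhds ?_)
    change covector (φ.symm x₀) 0 ∈ O
    rwa [hsymm]
  have hvq (q : Q) : simpleFunction g' v (covector q 0) = v q := by simp [simpleFunction]
  -- `V` restricted to the zero section is `v`, so positivity of `V` makes `q₀` a minimum.
  have hv0 : fderiv ℝ vl x₀ = 0 := by
    refine IsLocalMin.fderiv_eq_zero ?_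
    filter_upwards [hev] with x hx'
    have hz : vl x₀ = 0 := by
      have := hV.zero
      rw [hvq] at this
      simpa [hvl, hsymm] using this
    rw [hz]
    by_cases hne : covector (φ.symm x) 0 = covector q₀ 0
    · rw [hvl]
      dsimp only
      rw [← hvq, hne, hV.zero]
    · have := hV.pos _ hx'.2 hne
      rw [hvq] at this
      exact this.le
  let k : Plane → Plane := fun x => WithLp.toLp 2
    ![localCometric φ g 0 0 x * localMetric φ g' 0 0 x +
      localCometric φ g 0 1 x * localMetric φ g' 0 1 x,
      localCometric φ g 0 1 x * localMetric φ g' 0 0 x +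
      localCometric φ g 1 1 x * localMetric φ g' 0 1 x]
  have hk : DifferentiableAt ℝ k x₀ := by
    rw [differentiableAt_euclidean]
    intro i
    have hd (i j l m : Fin 2) := ((hA i j).mul (hM l m)).differentiableAt (by simp)
    fin_cases i
    · exact (hd 0 0 0 0).add (hd 0 1 0 1)
    · exact (hd 0 1 0 0).add (hd 1 1 0 1)
  have heq : ∀ᶠ x in 𝓝 x₀, fderiv ℝ vl x (k x) = fderiv ℝ hl x (EuclideanSpace.single 0 1) := by
    filter_upwards [hev] with x hx'
    exact potential_matching hφ hg hh hξ hU' hO hOU hY hg' hv hV.deriv_nonpos hx'.1 hx'.2 rfl rfl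
  have hS := hessian_apply_of_fderiv_eq hvs hhs hk hv0 heq (k x₀)
  have hG0 := localMetric_zero_zero_pos hφ hg' hx hxU'
  have hD := localMetric_det_pos hφ hg hx (mem_univ _)
  have hM0 := localMetric_zero_zero_pos hφ hg hx (mem_univ _)
  obtain ⟨e00, e01, -, e11⟩ := localCometric_eq hφ hg hx (mem_univ _) rfl
  set D := localMetric φ g 0 0 x₀ * localMetric φ g 1 1 x₀ - localMetric φ g 0 1 x₀ ^ 2 with hDdef
  -- `k` is the invertible cometric of `g` applied to a covector whose first component `g'₀₀` is
  -- positive.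
  have hk0 : k x₀ ≠ 0 := by
    intro hk0
    have h1 : k x₀ 0 = 0 := by rw [hk0]; rfl
    have h2 : k x₀ 1 = 0 := by rw [hk0]; rfl
    simp only [k, Matrix.cons_val_zero, Matrix.cons_val_one, e00, e01, e11] at h1 h2
    field_simp at h1 h2
    have h3 : D * localMetric φ g' 0 0 x₀ = 0 := by
      rw [hDdef]
      linear_combination localMetric φ g 0 0 x₀ * h1 + localMetric φ g 0 1 x₀ * h2
    exact (mul_pos hD hG0).ne' h3
  have hpos : 0 < fderiv ℝ (fderiv ℝ vl) x₀ (k x₀) (k x₀) := hhess _ hk0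
  rw [hS, fderiv_fderiv_comm hhs, clm_plane_apply] at hpos
  have hd0 : fderiv ℝ (fderiv ℝ hl) x₀ (EuclideanSpace.single 0 1) (EuclideanSpace.single 0 1) =
    secondPartial φ h 0 0 q₀ := rfl
  have hd1 : fderiv ℝ (fderiv ℝ hl) x₀ (EuclideanSpace.single 0 1) (EuclideanSpace.single 1 1) =
    secondPartial φ h 0 1 q₀ := rfl
  have hc (i j : Fin 2) : cometricCoeff φ g i j q₀ = localCometric φ g i j x₀ := by
    rw [localCometric, hsymm]
  rw [hc, hc, e01, e11] at h0
  rw [hd0, hd1] at hpos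
  simp only [k, Matrix.cons_val_zero, Matrix.cons_val_one, e00, e01, e11] at hpos
  set d₀ := secondPartial φ h 0 0 q₀
  set d₁ := secondPartial φ h 0 1 q₀
  refine pos_of_mul_pos_right (a := localMetric φ g' 0 0 x₀) ?_ hG0.le
  -- Given `h0`, the product of `g₀₀` with the quantity in `hpos` is exactly `g'₀₀ d₀`.
  have h1 := mul_pos hM0 hpos
  refine h1.trans_eq ?_
  field_simp at h0 ⊢
  rw [hDdef]
  linear_combination (localMetric φ g 0 0 x₀ * localMetric φ g' 0 1 x₀ -
    localMetric φ g 0 1 x₀ * localMetric φ g' 0 0 x₀) * h0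

end Necessity

/-! ### Integrals along lines and the second derivative test. -/

section Calculus

open MeasureTheory

theorem hasFDerivAt_parametric_intervalIntegral {E F : Type*} [NormedAddCommGroup E]
    [NormedSpace ℝ E] [ProperSpace E] [NormedAddCommGroup F] [NormedSpace ℝ F] [CompleteSpace F]
    {f : E × ℝ → F} (hf : ContDiff ℝ ∞ f) (a b : ℝ) (x : E) :
    HasFDerivAt (fun x => ∫ t in a..b, f (x, t))
      (∫ t in a..b, fderiv ℝ f (x, t) ∘L ContinuousLinearMap.inl ℝ E ℝ) x := by
  have hcont' : Continuous fun z : E × ℝ => fderiv ℝ f z ∘L ContinuousLinearMap.inl ℝ E ℝ :=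
    (hf.continuous_fderiv (by simp)).clm_comp continuous_const
  obtain ⟨C, hC⟩ := ((isCompact_closedBall x 1).prod
    (isCompact_uIcc (a := a) (b := b))).exists_bound_of_continuousOn hcont'.continuousOn
  refine intervalIntegral.hasFDerivAt_integral_of_dominated_of_fderiv_le (𝕜 := ℝ)
    (F := fun x t => f (x, t))
    (F' := fun x t => fderiv ℝ f (x, t) ∘L ContinuousLinearMap.inl ℝ E ℝ)
    (bound := fun _ => C) (Metric.closedBall_mem_nhds x one_pos) ?_ ?_ ?_ ?_ ?_ ?_
  · exact Eventually.of_forall fun y => Continuous.aestronglyMeasurable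
      (hf.continuous.comp (by fun_prop))
  · exact (hf.continuous.comp (by fun_prop)).intervalIntegrable _ _
  · exact (hcont'.comp (by fun_prop : Continuous fun t : ℝ => (x, t))).aestronglyMeasurable
  · exact Eventually.of_forall fun t ht y hy => hC (y, t) ⟨hy, uIoc_subset_uIcc ht⟩
  · exact intervalIntegrable_const
  · refine Eventually.of_forall fun t _ y _ => ?_
    have h1 : HasFDerivAt (fun y : E => (y, t)) (ContinuousLinearMap.inl ℝ E ℝ) y :=
      hasFDerivAt_prodMk_left y t
    exact ((hf.differentiable (by simp)) (y, t)).hasFDerivAt.comp y h1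

/-- The derivative of the integral is again such an integral, now valued in `E →L[ℝ] F`. The
induction therefore runs over all `F`, and `E` and `F` share a universe so that this space is
admissible. -/
theorem contDiff_parametric_intervalIntegral {E : Type} [NormedAddCommGroup E]
    [NormedSpace ℝ E] [ProperSpace E] (a b : ℝ) (n : ℕ) :
    ∀ {F : Type} [NormedAddCommGroup F] [NormedSpace ℝ F] [CompleteSpace F] {f : E × ℝ → F},
      ContDiff ℝ ∞ f → ContDiff ℝ n (fun x => ∫ t in a..b, f (x, t)) := by
  induction n with
  | zero =>
    intro F _ _ _ f hf
    refine contDiff_zero.2 ?_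
    exact intervalIntegral.continuous_parametric_intervalIntegral_of_continuous'
      (f := fun x t => f (x, t)) hf.continuous a b
  | succ n ih =>
    intro F _ _ _ f hf
    refine contDiff_succ_iff_hasFDerivAt.2
      ⟨_, ?_, hasFDerivAt_parametric_intervalIntegral hf a b⟩
    exact ih (f := fun z => fderiv ℝ f z ∘L ContinuousLinearMap.inl ℝ E ℝ)
      ((hf.fderiv_right (m := ∞) (by simp)).clm_comp contDiff_const)

/-- Integration along the lines of direction `n`: a smooth solution of `∂ₙ f = G` vanishing on
the hyperplane `ℓ = 0`. -/
theorem exists_fderiv_apply_eq {G : Plane → ℝ} (hG : ContDiff ℝ ∞ G) {n : Plane}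
    {ℓ : Plane →L[ℝ] ℝ} (hn : ℓ n = 1) :
    ∃ f : Plane → ℝ, ContDiff ℝ ∞ f ∧ (∀ x, fderiv ℝ f x n = G x) ∧ ∀ x, ℓ x = 0 → f x = 0 := by
  -- The integral from the hyperplane to `x` is rescaled to `[0, 1]`: fixed endpoints make
  -- smoothness in `x` visible, while the form `hfi` serves for differentiation.
  let f : Plane → ℝ := fun x => ∫ t in (0 : ℝ)..1, ℓ x * G (x - ℓ x • n + (t * ℓ x) • n)
  have hf : ContDiff ℝ ∞ f := by
    refine contDiff_infty.2 fun m => contDiff_parametric_intervalIntegral 0 1 m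
      (f := fun z : Plane × ℝ => ℓ z.1 * G (z.1 - ℓ z.1 • n + (z.2 * ℓ z.1) • n)) ?_
    fun_prop
  have hfi (x : Plane) : f x = ∫ t in (0 : ℝ)..ℓ x, G (x - ℓ x • n + t • n) := by
    have := intervalIntegral.mul_integral_comp_mul_right (a := 0) (b := 1)
      (f := fun t => G (x - ℓ x • n + t • n)) (ℓ x)
    simp only [zero_mul, one_mul] at this
    rw [← this, ← intervalIntegral.integral_const_mul]
  refine ⟨f, hf, fun x => ?_, fun x hx => ?_⟩
  · have hline : HasDerivAt (fun s : ℝ => x + s • n) n 0 := by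
      simpa using ((hasDerivAt_id (0 : ℝ)).smul_const n).const_add x
    have h1 : HasDerivAt (fun s : ℝ => f (x + s • n)) (fderiv ℝ f x n) 0 := by
      have h := ((hf.differentiable (by simp)) (x + (0 : ℝ) • n)).hasFDerivAt.comp_hasDerivAt
        (0 : ℝ) hline
      simpa [Function.comp_def] using h
    have hFTC : HasDerivAt (fun u : ℝ => ∫ t in (0 : ℝ)..u, G (x - ℓ x • n + t • n))
        (G (x - ℓ x • n + ℓ x • n)) (ℓ x) := by
      have hc : Continuous fun t : ℝ => G (x - ℓ x • n + t • n) :=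
        hG.continuous.comp (by fun_prop)
      exact hc.integral_hasStrictDerivAt 0 (ℓ x) |>.hasDerivAt
    -- Moving along `n` leaves the foot `x - ℓ x • n` unchanged, so only the upper endpoint varies.
    have h2 : HasDerivAt (fun s : ℝ => f (x + s • n)) (G x) 0 := by
      have hs : HasDerivAt (fun s : ℝ => ℓ x + s) 1 0 := (hasDerivAt_id (0 : ℝ)).const_add _
      have hFTC' : HasDerivAt (fun u : ℝ => ∫ t in (0 : ℝ)..u, G (x - ℓ x • n + t • n))
        (G x) (ℓ x + 0) := by simpa using hFTC
      have h := hFTC'.comp (0 : ℝ) hs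
      rw [mul_one] at h
      refine h.congr_of_eventuallyEq (Eventually.of_forall fun s => ?_)
      have e1 : ℓ (x + s • n) = ℓ x + s := by simp [hn]
      have e2 : x + s • n - (ℓ x + s) • n = x - ℓ x • n := by
        rw [add_smul]; abel
      simp only [hfi, e1, e2, Function.comp_apply]
    exact h1.unique h2
  · simp [f, hx]

theorem exists_pos_bound_of_pos {B : Plane →L[ℝ] Plane →L[ℝ] ℝ} (hB : ∀ u, u ≠ 0 → 0 < B u u) :
    ∃ c > 0, ∀ u, c * ‖u‖ ^ 2 ≤ B u u := by
  have hne : (Metric.sphere (0 : Plane) 1).Nonempty := NormedSpace.sphere_nonempty.2 zero_le_one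
  have hcont : Continuous fun u => B u u := by fun_prop
  obtain ⟨u₀, hu₀, hmin⟩ := (isCompact_sphere (0 : Plane) 1).exists_isMinOn hne hcont.continuousOn
  have hu₀' : u₀ ≠ 0 := by
    rintro rfl
    simp at hu₀
  refine ⟨B u₀ u₀, hB u₀ hu₀', fun u => ?_⟩
  by_cases hu : u = 0
  · simp [hu]
  have h1 : ‖u‖⁻¹ • u ∈ Metric.sphere (0 : Plane) 1 := by
    simp [norm_smul, hu]
  have h2 : B u₀ u₀ ≤ B (‖u‖⁻¹ • u) (‖u‖⁻¹ • u) := hmin h1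
  have hpos : 0 < ‖u‖ := norm_pos_iff.2 hu
  simp only [map_smul, smul_apply, smul_eq_mul] at h2
  calc B u₀ u₀ * ‖u‖ ^ 2 ≤ (‖u‖⁻¹ * (‖u‖⁻¹ * B u u)) * ‖u‖ ^ 2 := by gcongr
    _ = B u u := by field_simp

/-- The second derivative test for strict local minima. -/
theorem eventually_pos_of_fderiv_fderiv_pos {v : Plane → ℝ} {x : Plane}
    (hv : ContDiffAt ℝ ∞ v x) (h0 : v x = 0) (h1 : fderiv ℝ v x = 0)
    (h2 : ∀ u, u ≠ 0 → 0 < fderiv ℝ (fderiv ℝ v) x u u) :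
    ∀ᶠ y in 𝓝 x, y ≠ x → 0 < v y := by
  obtain ⟨c, hc, hB⟩ := exists_pos_bound_of_pos h2
  set B := fderiv ℝ (fderiv ℝ v) x with hBdef
  have hsymm : ∀ u w, B u w = B w u := fderiv_fderiv_comm hv
  have hdv : HasFDerivAt (fderiv ℝ v) B x :=
    ((hv.fderiv_right (m := ∞) (by simp)).differentiableAt (by simp)).hasFDerivAt
  -- The quadratic part of `v` is at least `c / 2 * ‖y - x‖ ^ 2`. A gradient error of `c / 4 * ‖y -
  -- x‖` on the ball leaves, by the mean value inequality, half of it.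
  have ho := hdv.isLittleO.def (c := c / 4) (by positivity)
  have hdiff : ∀ᶠ y in 𝓝 x, DifferentiableAt ℝ v y := by
    filter_upwards [(hv.of_le (m := 1) (by simp)).eventually (by simp)] with y hy
    exact hy.differentiableAt (by simp)
  obtain ⟨r, hr, hball⟩ := Metric.eventually_nhds_iff_ball.1 (ho.and hdiff)
  filter_upwards [Metric.ball_mem_nhds x hr] with y hy hne
  let R : Plane → ℝ := fun y => v y - 1 / 2 * B (y - x) (y - x)
  have hR : ∀ y' ∈ Metric.closedBall x ‖y - x‖, HasFDerivWithinAt R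
      (fderiv ℝ v y' - B (y' - x)) (Metric.closedBall x ‖y - x‖) y' := by
    intro y' hy'
    have hy'' : y' ∈ Metric.ball x r := by
      rw [Metric.mem_closedBall] at hy'
      rw [Metric.mem_ball] at hy ⊢
      rw [dist_eq_norm] at hy
      linarith
    have e1 := (hball y' hy'').2.hasFDerivAt
    have e2 : HasFDerivAt (fun y => y - x) (ContinuousLinearMap.id ℝ Plane) y' :=
      (hasFDerivAt_id y').sub_const x
    have e3 := (B.hasFDerivAt.comp y' e2).clm_apply e2
    have e4 := e1.sub (e3.const_mul (1 / 2))
    refine (e4.congr_fderiv ?_).hasFDerivWithinAt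
    ext u
    simp [hsymm u]
    ring
  have hbound : ∀ y' ∈ Metric.closedBall x ‖y - x‖,
      ‖fderiv ℝ v y' - B (y' - x)‖ ≤ c / 4 * ‖y - x‖ := by
    intro y' hy'
    have hle : ‖y' - x‖ ≤ ‖y - x‖ := by
      rwa [Metric.mem_closedBall, dist_eq_norm] at hy'
    have hy'' : y' ∈ Metric.ball x r := by
      rw [Metric.mem_ball, dist_eq_norm] at hy ⊢
      linarith
    have := (hball y' hy'').1
    rw [h1, sub_zero] at this
    refine this.trans ?_
    gcongr
  have hmv := (convex_closedBall x ‖y - x‖).norm_image_sub_le_of_norm_hasFDerivWithin_le hR hbound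
    (Metric.mem_closedBall_self (norm_nonneg _)) (y := y) (by simp [dist_eq_norm])
  have hRx : R x = 0 := by simp [R, h0]
  rw [hRx, sub_zero, Real.norm_eq_abs] at hmv
  have h3 := (abs_le.1 hmv).1
  have h4 := hB (y - x)
  have h5 : 0 < ‖y - x‖ := norm_pos_iff.2 (sub_ne_zero.2 hne)
  have h6 : 0 < c * ‖y - x‖ ^ 2 := by positivity
  simp only [R] at h3
  nlinarith

end Calculus

/-! ### The force that makes the Lyapunov function a first integral. -/

section MatchingForce

/-- The partial derivatives of a function on the plane. -/
def pderiv (i : Fin 2) (f : Plane → ℝ) (x : Plane) : ℝ :=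
  fderiv ℝ f x (EuclideanSpace.single i 1)

theorem contDiffAt_pderiv {f : Plane → ℝ} {x : Plane} (hf : ContDiffAt ℝ ∞ f x) (i : Fin 2) :
    ContDiffAt ℝ ∞ (pderiv i f) x :=
  (hf.fderiv_right (m := ∞) (by simp)).clm_apply contDiffAt_const

theorem fderiv_apply_eq_pderiv (f : Plane → ℝ) (x u : Plane) :
    fderiv ℝ f x u = u 0 * pderiv 0 f x + u 1 * pderiv 1 f x :=
  clm_plane_apply _ u

/-- The force that keeps `½ (p₀² / f + f (p₁ - r p₀)²) + v` constant. -/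
def matchingForce (a b c h f r v : Plane → ℝ) (z : Plane × Plane) : ℝ :=
  1 / 2 * (pderiv 1 a z.1 * z.2 0 ^ 2 + 2 * pderiv 1 b z.1 * z.2 0 * z.2 1 +
    pderiv 1 c z.1 * z.2 1 ^ 2) + pderiv 1 h z.1 -
  (f z.1)⁻¹ * (-(1 / 2) * (b z.1 * pderiv 0 f z.1 + c z.1 * pderiv 1 f z.1) * z.2 0 ^ 2 *
      (f z.1)⁻¹ ^ 2 +
    1 / 2 * ((a z.1 * z.2 0 + b z.1 * z.2 1) * pderiv 0 f z.1 +
      (b z.1 * z.2 0 + c z.1 * z.2 1) * pderiv 1 f z.1) * (z.2 1 - r z.1 * z.2 0) -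
    f z.1 * ((a z.1 * z.2 0 + b z.1 * z.2 1) * pderiv 0 r z.1 +
      (b z.1 * z.2 0 + c z.1 * z.2 1) * pderiv 1 r z.1) * z.2 0 +
    (b z.1 * pderiv 0 v z.1 + c z.1 * pderiv 1 v z.1) -
    (f z.1)⁻¹ * z.2 0 * (z.2 0 * (pderiv 0 b z.1 + pderiv 0 c z.1 * r z.1) +
      1 / 2 * (z.2 1 - r z.1 * z.2 0) * pderiv 0 c z.1) +
    r z.1 * f z.1 * (1 / 2 * (pderiv 0 a z.1 * z.2 0 ^ 2 + 2 * pderiv 0 b z.1 * z.2 0 * z.2 1 +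
      pderiv 0 c z.1 * z.2 1 ^ 2) + pderiv 0 h z.1))

theorem contDiffAt_matchingForce {a b c h f r v : Plane → ℝ} {z : Plane × Plane}
    (ha : ContDiffAt ℝ ∞ a z.1) (hb : ContDiffAt ℝ ∞ b z.1) (hc : ContDiffAt ℝ ∞ c z.1)
    (hh : ContDiffAt ℝ ∞ h z.1) (hf : ContDiffAt ℝ ∞ f z.1) (hr : ContDiffAt ℝ ∞ r z.1)
    (hv : ContDiffAt ℝ ∞ v z.1) (hf0 : f z.1 ≠ 0) :
    ContDiffAt ℝ ∞ (matchingForce a b c h f r v) z := by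
  have hp (i : Fin 2) : ContDiffAt ℝ ∞ (fun z : Plane × Plane => z.2 i) z := by fun_prop
  have lift {g : Plane → ℝ} (hg : ContDiffAt ℝ ∞ g z.1) :
      ContDiffAt ℝ ∞ (fun z : Plane × Plane => g z.1) z := hg.comp z contDiffAt_fst
  have hfi := lift (hf.inv hf0)
  have hd {g : Plane → ℝ} (hg : ContDiffAt ℝ ∞ g z.1) (i : Fin 2) :=
    lift (contDiffAt_pderiv hg i)
  have ha' := lift ha
  have hb' := lift hb
  have hc' := lift hc
  have hf' := lift hf
  have hr' := lift hr
  have hk₀ := (ha'.mul (hp 0)).add (hb'.mul (hp 1))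
  have hk₁ := (hb'.mul (hp 0)).add (hc'.mul (hp 1))
  have hδ := (hp 1).sub (hr'.mul (hp 0))
  have hq (i : Fin 2) := (contDiffAt_const (c := (1 / 2 : ℝ))).mul
    ((((hd ha i).mul ((hp 0).pow 2)).add
    ((((contDiffAt_const (c := (2 : ℝ))).mul (hd hb i)).mul (hp 0)).mul (hp 1))).add
      ((hd hc i).mul ((hp 1).pow 2)))
  have h1 := (((contDiffAt_const (c := (-(1 / 2) : ℝ))).mul
    ((hb'.mul (hd hf 0)).add (hc'.mul (hd hf 1)))).mul ((hp 0).pow 2)).mul (hfi.pow 2)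
  have h2 := ((contDiffAt_const (c := (1 / 2 : ℝ))).mul
    ((hk₀.mul (hd hf 0)).add (hk₁.mul (hd hf 1)))).mul hδ
  have h3 := (hf'.mul ((hk₀.mul (hd hr 0)).add (hk₁.mul (hd hr 1)))).mul (hp 0)
  have h4 := (hb'.mul (hd hv 0)).add (hc'.mul (hd hv 1))
  have h5 := (hfi.mul (hp 0)).mul (((hp 0).mul ((hd hb 0).add ((hd hc 0).mul hr'))).add
    (((contDiffAt_const (c := (1 / 2 : ℝ))).mul hδ).mul (hd hc 0)))
  have h6 := (hr'.mul hf').mul ((hq 0).add (hd hh 0))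
  exact ((hq 1).add (hd hh 1)).sub (hfi.mul (((((h1.add h2).sub h3).add h4).sub h5).add h6))

/-- Here `∂V/∂p₁ = f (p₁ - r p₀)`. By `hkin` and `hpot` the uncontrolled derivative of `V` vanishes
on `p₁ = r p₀`, hence is divisible by `p₁ - r p₀`. `matchingForce` is the negative of the quotient
by `f (p₁ - r p₀)`, written without that factor in a denominator, so it stays smooth there. -/
theorem fderiv_planeSimple_matchingForce {a b c h f r v : Plane → ℝ} {z : Plane × Plane}
    (ha : DifferentiableAt ℝ a z.1) (hb : DifferentiableAt ℝ b z.1)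
    (hc : DifferentiableAt ℝ c z.1) (hh : DifferentiableAt ℝ h z.1)
    (hf : DifferentiableAt ℝ f z.1) (hr : DifferentiableAt ℝ r z.1)
    (hv : DifferentiableAt ℝ v z.1) (hf0 : f z.1 ≠ 0)
    (hkin : (a z.1 + b z.1 * r z.1) * pderiv 0 f z.1 + (b z.1 + c z.1 * r z.1) * pderiv 1 f z.1 =
      -(f z.1 * (pderiv 0 a z.1 + 2 * pderiv 0 b z.1 * r z.1 + pderiv 0 c z.1 * r z.1 ^ 2)))
    (hpot : f z.1 * ((a z.1 + b z.1 * r z.1) * pderiv 0 v z.1 +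
      (b z.1 + c z.1 * r z.1) * pderiv 1 v z.1) = pderiv 0 h z.1) :
    fderiv ℝ (planeSimple (fun x => (f x)⁻¹ + r x ^ 2 * f x) (fun x => -(r x * f x)) f v) z
      (planeField (planeSimple a b c h) z +
        (0, EuclideanSpace.single 1 (matchingForce a b c h f r v z))) = 0 := by
  have hF₀ : HasFDerivAt (fun x => (f x)⁻¹ + r x ^ 2 * f x) _ z.1 :=
    ((hasFDerivAt_inv hf0).comp z.1 hf.hasFDerivAt).add
      ((hr.hasFDerivAt.pow 2).mul hf.hasFDerivAt)
  have hF₁ : HasFDerivAt (fun x => -(r x * f x)) _ z.1 := (hr.hasFDerivAt.mul hf.hasFDerivAt).neg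
  rw [fderiv_planeSimple_planeField
    (k := WithLp.toLp 2 ![a z.1 * z.2 0 + b z.1 * z.2 1, b z.1 * z.2 0 + c z.1 * z.2 1])
    ha hb hc hh hF₀.differentiableAt hF₁.differentiableAt hf hv _ rfl rfl rfl rfl,
    hF₀.fderiv, hF₁.fderiv]
  change _ - _ * (1 / 2 * (pderiv 0 a z.1 * _ + 2 * pderiv 0 b z.1 * _ * _ + pderiv 0 c z.1 * _) +
    pderiv 0 h z.1) + _ * (_ - (1 / 2 * (pderiv 1 a z.1 * _ + 2 * pderiv 1 b z.1 * _ * _ +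
    pderiv 1 c z.1 * _) + pderiv 1 h z.1)) = 0
  simp only [add_apply, smul_apply, neg_apply, ContinuousLinearMap.comp_apply,
    fderiv_apply_eq_pderiv, ContinuousLinearMap.toSpanSingleton_apply, smul_eq_mul, nsmul_eq_mul,
    Matrix.cons_val_zero, Matrix.cons_val_one, matchingForce, Nat.cast_ofNat, ← inv_pow,
    show 2 - 1 = 1 from rfl, pow_one]
  -- With the inverse an independent variable `i` subject to `f * i = 1`, the claim is a polynomial
  -- identity.
  have hfi : f z.1 * (f z.1)⁻¹ = 1 := mul_inv_cancel₀ hf0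
  generalize (f z.1)⁻¹ = i at *
  generalize pderiv 0 f z.1 = f0 at *
  generalize pderiv 1 f z.1 = f1 at *
  generalize pderiv 0 a z.1 = a0 at *
  generalize pderiv 1 a z.1 = a1 at *
  generalize pderiv 0 b z.1 = b0 at *
  generalize pderiv 1 b z.1 = b1 at *
  generalize pderiv 0 c z.1 = c0 at *
  generalize pderiv 1 c z.1 = c1 at *
  generalize pderiv 0 h z.1 = h0 at *
  generalize pderiv 1 h z.1 = h1 at *
  generalize pderiv 0 r z.1 = r0 at *
  generalize pderiv 1 r z.1 = r1 at *
  generalize pderiv 0 v z.1 = v0 at *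
  generalize pderiv 1 v z.1 = v1 at *
  generalize f z.1 = f at *
  generalize a z.1 = a at *
  generalize b z.1 = b at *
  generalize c z.1 = c at *
  generalize r z.1 = r at *
  generalize z.2 0 = s at *
  generalize z.2 1 = t at *
  -- On `t = r * s` the cubic part is a multiple of `hkin` and the linear part a multiple of `hpot`.
  -- The coefficient of `hfi` cancels the factor `f` of `∂V/∂p₁` against the leading `i` in the
  -- force.
  linear_combination (-(1 / 2) * i ^ 2 * s ^ 3) * hkin + (i * s) * hpot +
    (-(t - r * s) * (-(1 / 2) * (b * f0 + c * f1) * s ^ 2 * i ^ 2 +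
      1 / 2 * ((a * s + b * t) * f0 + (b * s + c * t) * f1) * (t - r * s) -
      f * ((a * s + b * t) * r0 + (b * s + c * t) * r1) * s + (b * v0 + c * v1) -
      i * s * (s * (b0 + c0 * r) + 1 / 2 * (t - r * s) * c0) +
      r * f * (1 / 2 * (a0 * s ^ 2 + 2 * b0 * s * t + c0 * t ^ 2) + h0))
      - s * ((a + b * r) * v0 + (b + c * r) * v1)
      + 1 / 2 * i * (a0 + 2 * b0 * r + c0 * r ^ 2) * s ^ 3) * hfi

end MatchingForce

/-! ### Potentials with a prescribed directional derivative. -/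

section Potential

/-- Integration along lines needs a globally smooth integrand, while the coefficients are smooth
only near the origin; a bump function bridges the two. -/
theorem exists_contDiff_eventuallyEq {f : Plane → ℝ} {x₀ : Plane}
    (hf : ∀ᶠ x in 𝓝 x₀, ContDiffAt ℝ ∞ f x) :
    ∃ F : Plane → ℝ, ContDiff ℝ ∞ F ∧ F =ᶠ[𝓝 x₀] f := by
  obtain ⟨r, hr, hball⟩ := Metric.eventually_nhds_iff_ball.1 hf
  let χ : ContDiffBump x₀ := ⟨r / 4, r / 2, by positivity, by linarith⟩
  refine ⟨fun x => χ x * f x, ?_, ?_⟩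
  · rw [contDiff_iff_contDiffAt]
    intro x
    by_cases hx : x ∈ Metric.ball x₀ r
    · exact χ.contDiffAt.mul (hball x hx)
    · refine (contDiffAt_const (c := (0 : ℝ))).congr_of_eventuallyEq ?_
      have hx' : x ∉ tsupport χ := by
        rw [χ.tsupport_eq, Metric.mem_closedBall]
        rw [Metric.mem_ball] at hx
        change ¬ dist x x₀ ≤ r / 2
        linarith
      filter_upwards [(isClosed_tsupport χ).isOpen_compl.mem_nhds hx'] with y hy
      rw [image_eq_zero_of_notMem_tsupport hy, zero_mul]
  · filter_upwards [χ.eventuallyEq_one] with y hy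
    rw [hy, Pi.one_apply, one_mul]

theorem hasFDerivAt_fderiv_apply {P : Plane → ℝ} (hP : ContDiff ℝ ∞ P) (x e : Plane) :
    HasFDerivAt (fun y => fderiv ℝ P y e) ((fderiv ℝ (fderiv ℝ P) x).flip e) x := by
  have h1 : ContDiff ℝ ∞ (fderiv ℝ P) := hP.fderiv_right (by simp)
  have h2 := (h1.differentiable (by simp) x).hasFDerivAt
  exact (ContinuousLinearMap.apply ℝ ℝ e).hasFDerivAt.comp x h2

/-- A smooth function with prescribed derivative `G` in the direction `n` and a nondegenerate
minimum at the origin. -/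
theorem exists_potential {G : Plane → ℝ} (hG : ContDiff ℝ ∞ G) (hG0 : G 0 = 0) {n : Plane}
    (hn : 0 < fderiv ℝ G 0 n) :
    ∃ v : Plane → ℝ, ContDiff ℝ ∞ v ∧ (∀ x, fderiv ℝ v x n = G x) ∧ v 0 = 0 ∧
      fderiv ℝ v 0 = 0 ∧ ∀ u, u ≠ 0 → 0 < fderiv ℝ (fderiv ℝ v) 0 u u := by
  have hN : 0 < n 0 ^ 2 + n 1 ^ 2 := by
    by_contra hle
    have h0 : n 0 = 0 := by nlinarith [sq_nonneg (n 0), sq_nonneg (n 1)]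
    have h1 : n 1 = 0 := by nlinarith [sq_nonneg (n 0), sq_nonneg (n 1)]
    rw [clm_plane_apply, h0, h1] at hn
    simp at hn
  set N := n 0 ^ 2 + n 1 ^ 2 with hNdef
  let pr (i : Fin 2) : Plane →L[ℝ] ℝ := EuclideanSpace.proj i
  let ℓ : Plane →L[ℝ] ℝ := N⁻¹ • (n 0 • pr 0 + n 1 • pr 1)
  let ℓ' : Plane →L[ℝ] ℝ := N⁻¹ • (n 0 • pr 1 - n 1 • pr 0)
  -- `e` is `n` turned by a right angle, and `ℓ`, `ℓ'` are the basis dual to `n`, `e`.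
  let e : Plane := WithLp.toLp 2 ![-n 1, n 0]
  have hℓ (u : Plane) : ℓ u = N⁻¹ * (n 0 * u 0 + n 1 * u 1) := rfl
  have hℓ' (u : Plane) : ℓ' u = N⁻¹ * (n 0 * u 1 - n 1 * u 0) := rfl
  have he0 : e 0 = -n 1 := rfl
  have he1 : e 1 = n 0 := rfl
  have hℓn : ℓ n = 1 := by rw [hℓ]; field_simp; rw [hNdef]
  have hℓe : ℓ e = 0 := by rw [hℓ, he0, he1]; ring
  have hℓ'n : ℓ' n = 0 := by rw [hℓ']; ring
  have hdecomp (u : Plane) : u = ℓ u • n + ℓ' u • e := by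
    ext i
    fin_cases i
    · change u 0 = ℓ u * n 0 + ℓ' u * e 0
      rw [hℓ, hℓ', he0]; field_simp; rw [hNdef]; ring
    · change u 1 = ℓ u * n 1 + ℓ' u * e 1
      rw [hℓ, hℓ', he1]; field_simp; rw [hNdef]; ring
  obtain ⟨P, hP, hPn, hP0⟩ := exists_fderiv_apply_eq hG hℓn
  have hPe (s : ℝ) : fderiv ℝ P (s • e) e = 0 := by
    have h1 : HasDerivAt (fun s : ℝ => s • e) e s := by
      simpa using (hasDerivAt_id s).smul_const e
    have h2 := ((hP.differentiable (by simp)) (s • e)).hasFDerivAt.comp_hasDerivAt s h1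
    have h3 : P ∘ (fun s : ℝ => s • e) = fun _ => 0 := by
      funext s
      exact hP0 _ (by simp [hℓe])
    rw [h3] at h2
    exact h2.unique (hasDerivAt_const s 0)
  have hdP : ContDiff ℝ ∞ (fderiv ℝ P) := hP.fderiv_right (by simp)
  have hddP (x : Plane) : HasFDerivAt (fderiv ℝ P) (fderiv ℝ (fderiv ℝ P) x) x :=
    (hdP.differentiable (by simp) x).hasFDerivAt
  -- `P` vanishes on the line spanned by `e`, where `ℓ = 0`.
  have hPee : fderiv ℝ (fderiv ℝ P) 0 e e = 0 := by
    have h1 : HasDerivAt (fun s : ℝ => s • e) e 0 := by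
      simpa using (hasDerivAt_id (0 : ℝ)).smul_const e
    have h2 := hasFDerivAt_fderiv_apply hP ((0 : ℝ) • e) e
    have h3 := h2.comp_hasDerivAt (0 : ℝ) h1
    have h4 : (fun y => fderiv ℝ P y e) ∘ (fun s : ℝ => s • e) = fun _ => 0 := funext hPe
    rw [h4, zero_smul] at h3
    exact h3.unique (hasDerivAt_const _ _)
  have hPun (u : Plane) : fderiv ℝ (fderiv ℝ P) 0 u n = fderiv ℝ G 0 u := by
    have h1 := hasFDerivAt_fderiv_apply hP 0 n
    simp only [hPn] at h1
    rw [h1.fderiv]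
    rfl
  set A := fderiv ℝ G 0 n with hA
  set B := fderiv ℝ G 0 e with hB
  -- In the basis `n`, `e` the Hessian of `P` is `(A B; B 0)`. Adding `K / 2 * ℓ' ^ 2` does not
  -- affect the derivative along `n` and puts `K` in the corner; `K` exceeds the threshold `B ^ 2 /
  -- A` for positivity.
  let K := B ^ 2 / A + 1
  let v : Plane → ℝ := fun x => P x + K / 2 * ℓ' x ^ 2
  have hdv (x : Plane) : HasFDerivAt v (fderiv ℝ P x + (K * ℓ' x) • ℓ') x := by
    have h1 := (hP.differentiable (by simp) x).hasFDerivAt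
    have h2 := (ℓ'.hasFDerivAt (x := x)).pow 2 |>.const_mul (K / 2)
    refine (h1.add h2).congr_fderiv ?_
    ext u
    simp
    ring
  have hfdv : fderiv ℝ v = fun x => fderiv ℝ P x + (K * ℓ' x) • ℓ' := funext fun x => (hdv x).fderiv
  have hddv (u w : Plane) : fderiv ℝ (fderiv ℝ v) 0 u w =
      fderiv ℝ (fderiv ℝ P) 0 u w + K * ℓ' u * ℓ' w := by
    have h1 := (hddP 0).add (((ℓ'.hasFDerivAt (x := (0 : Plane))).const_mul K).smul_const ℓ')
    rw [hfdv]
    erw [h1.fderiv]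
    simp
  refine ⟨v, ?_, fun x => ?_, ?_, ?_, fun u hu => ?_⟩
  · have := ℓ'.contDiff (n := ∞)
    fun_prop
  · rw [hfdv]; simp [hPn, hℓ'n]
  · simp [v, hP0 0 (by simp)]
  · rw [hfdv]
    ext u
    have h1 := hPe 0
    rw [zero_smul] at h1
    rw [hdecomp u]
    simp only [map_zero, mul_zero, zero_smul, add_zero, map_add, map_smul, hPn, hG0, h1]
    simp
  · rw [hddv]
    have hsymm := fderiv_fderiv_comm (hP.contDiffAt (x := 0))
    have h1 : fderiv ℝ (fderiv ℝ P) 0 u u = ℓ u ^ 2 * A + 2 * (ℓ u * ℓ' u) * B := by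
      conv_lhs => rw [hdecomp u]
      simp only [map_add, map_smul, add_apply, smul_apply, smul_eq_mul, hPee, hsymm n e, hPun]
      ring
    have h2 : A * (ℓ u + ℓ' u * (B / A)) ^ 2 + ℓ' u ^ 2 =
        fderiv ℝ (fderiv ℝ P) 0 u u + K * ℓ' u * ℓ' u := by
      rw [h1]
      simp only [K]
      field_simp
      ring
    rw [← h2]
    by_cases h0 : ℓ' u = 0
    · have h3 : ℓ u ≠ 0 := fun h3 => hu (by rw [hdecomp u, h0, h3]; simp)
      rw [h0]
      have : 0 < ℓ u ^ 2 := by positivity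
      simp only [zero_mul, add_zero]
      positivity
    · positivity

/-- The kinetic matching condition, from the relations `A (m, m') = (n₀, n₁)`. -/
theorem pderiv_cometric_relation {a b c m m' : Plane → ℝ} {x : Plane} {n₀ n₁ : ℝ}
    (ha : DifferentiableAt ℝ a x) (hb : DifferentiableAt ℝ b x) (hc : DifferentiableAt ℝ c x)
    (hm : DifferentiableAt ℝ m x) (hm' : DifferentiableAt ℝ m' x)
    (h₀ : ∀ᶠ y in 𝓝 x, a y * m y + b y * m' y = n₀)
    (h₁ : ∀ᶠ y in 𝓝 x, b y * m y + c y * m' y = n₁) :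
    pderiv 0 a x * m x ^ 2 + 2 * pderiv 0 b x * m x * m' x + pderiv 0 c x * m' x ^ 2 =
      -(n₀ * pderiv 0 m x + n₁ * pderiv 0 m' x) := by
  have e0 := ((ha.hasFDerivAt.mul hm.hasFDerivAt).add
    (hb.hasFDerivAt.mul hm'.hasFDerivAt)).unique
      ((hasFDerivAt_const n₀ x).congr_of_eventuallyEq h₀)
  have e1 := ((hb.hasFDerivAt.mul hm.hasFDerivAt).add
    (hc.hasFDerivAt.mul hm'.hasFDerivAt)).unique
      ((hasFDerivAt_const n₁ x).congr_of_eventuallyEq h₁)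
  have e0' := DFunLike.congr_fun e0 (EuclideanSpace.single 0 1)
  have e1' := DFunLike.congr_fun e1 (EuclideanSpace.single 0 1)
  simp only [add_apply, smul_apply, smul_eq_mul, zero_apply] at e0' e1'
  rw [← h₀.self_of_nhds, ← h₁.self_of_nhds]
  simp only [pderiv]
  -- The relation `A (m, m') = n` differentiated in the first coordinate is paired with `(m, m')`;
  -- the symmetry of `A` does the rest.
  linear_combination m x * e0' + m' x * e1'

end Potential

/-! ### Solving the kinetic and potential matching equations. -/

section Matching

/-- In the application the first inequality is `m 0 > 0` and the second is positivity of the Hessian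
of `h` on `(∂/∂x, n)`. These are two open half-planes for `n`; they meet unless their normals are
opposite, which the hypothesis excludes. -/
theorem exists_direction {b c Δ d₀ d₁ : ℝ} (hc : 0 < c) (hΔ : 0 < Δ)
    (h : b * d₀ + c * d₁ ≠ 0 ∨ 0 < d₀) :
    ∃ n : Plane, 0 < (c * n 0 - b * n 1) / Δ ∧ 0 < d₀ * n 0 + d₁ * n 1 := by
  rcases h with h | h
  · refine ⟨WithLp.toLp 2 ![(d₁ + b) / (b * d₀ + c * d₁), (c - d₀) / (b * d₀ + c * d₁)], ?_, ?_⟩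
    · refine div_pos (lt_of_lt_of_eq one_pos ?_) hΔ
      simp only [Matrix.cons_val_zero, Matrix.cons_val_one]
      field_simp
      ring
    · refine lt_of_lt_of_eq one_pos ?_
      simp only [Matrix.cons_val_zero, Matrix.cons_val_one]
      rw [mul_div_assoc', mul_div_assoc', ← add_div, eq_div_iff h]
      ring
  · refine ⟨EuclideanSpace.single 0 1, ?_, ?_⟩
    · simpa using div_pos hc hΔ
    · simpa using h

/-- Solutions `f`, `r` of the kinetic and `v` of the potential matching equations. -/
theorem exists_matching {a b c h : Plane → ℝ} (ha : ∀ᶠ x in 𝓝 0, ContDiffAt ℝ ∞ a x)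
    (hb : ∀ᶠ x in 𝓝 0, ContDiffAt ℝ ∞ b x) (hc : ∀ᶠ x in 𝓝 0, ContDiffAt ℝ ∞ c x)
    (hh : ∀ᶠ x in 𝓝 0, ContDiffAt ℝ ∞ h x) (hc0 : 0 < c 0) (hΔ : 0 < a 0 * c 0 - b 0 ^ 2)
    (hh0 : fderiv ℝ h 0 = 0)
    (hcond : b 0 *
      fderiv ℝ (fderiv ℝ h) 0 (EuclideanSpace.single 0 1) (EuclideanSpace.single 0 1) +
      c 0 * fderiv ℝ (fderiv ℝ h) 0 (EuclideanSpace.single 0 1) (EuclideanSpace.single 1 1) ≠ 0 ∨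
      0 < fderiv ℝ (fderiv ℝ h) 0 (EuclideanSpace.single 0 1) (EuclideanSpace.single 0 1)) :
    ∃ f r v : Plane → ℝ, v 0 = 0 ∧ fderiv ℝ v 0 = 0 ∧
      (∀ u, u ≠ 0 → 0 < fderiv ℝ (fderiv ℝ v) 0 u u) ∧
      ∀ᶠ x in 𝓝 0, ContDiffAt ℝ ∞ f x ∧ ContDiffAt ℝ ∞ r x ∧ ContDiffAt ℝ ∞ v x ∧ 0 < f x ∧
        (x ≠ 0 → 0 < v x) ∧
        ((a x + b x * r x) * pderiv 0 f x + (b x + c x * r x) * pderiv 1 f x =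
          -(f x * (pderiv 0 a x + 2 * pderiv 0 b x * r x + pderiv 0 c x * r x ^ 2))) ∧
        f x * ((a x + b x * r x) * pderiv 0 v x + (b x + c x * r x) * pderiv 1 v x) =
          pderiv 0 h x := by
  obtain ⟨n, hn1, hn2⟩ := exists_direction hc0 hΔ hcond
  -- `(m, m')` is the inverse cometric applied to the constant `n`, so with `r = m' / m` the field
  -- `A (1, r)` is `n / m`.
  let m : Plane → ℝ := fun x => (c x * n 0 - b x * n 1) / (a x * c x - b x ^ 2)
  let m' : Plane → ℝ := fun x => (a x * n 1 - b x * n 0) / (a x * c x - b x ^ 2)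
  have hΔs : ∀ᶠ x in 𝓝 0, ContDiffAt ℝ ∞ (fun x => a x * c x - b x ^ 2) x := by
    filter_upwards [ha, hb, hc] with x h1 h2 h3 using (h1.mul h3).sub (h2.pow 2)
  have hΔ' : ∀ᶠ x in 𝓝 0, 0 < a x * c x - b x ^ 2 :=
    hΔs.self_of_nhds.continuousAt.eventually (lt_mem_nhds hΔ)
  have hm : ∀ᶠ x in 𝓝 0, ContDiffAt ℝ ∞ m x := by
    filter_upwards [hb, hc, hΔs, hΔ'] with x h2 h3 h4 h5
    exact ((h3.mul contDiffAt_const).sub (h2.mul contDiffAt_const)).div h4 h5.ne'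
  have hm' : ∀ᶠ x in 𝓝 0, ContDiffAt ℝ ∞ m' x := by
    filter_upwards [hb, ha, hΔs, hΔ'] with x h2 h3 h4 h5
    exact ((h3.mul contDiffAt_const).sub (h2.mul contDiffAt_const)).div h4 h5.ne'
  have hmpos : ∀ᶠ x in 𝓝 0, 0 < m x := hm.self_of_nhds.continuousAt.eventually (lt_mem_nhds hn1)
  have hrel0 : ∀ᶠ x in 𝓝 0, a x * m x + b x * m' x = n 0 := by
    filter_upwards [hΔ'] with x hx
    simp only [m, m']
    rw [mul_div_assoc', mul_div_assoc', ← add_div, div_eq_iff hx.ne']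
    ring
  have hrel1 : ∀ᶠ x in 𝓝 0, b x * m x + c x * m' x = n 1 := by
    filter_upwards [hΔ'] with x hx
    simp only [m, m']
    rw [mul_div_assoc', mul_div_assoc', ← add_div, div_eq_iff hx.ne']
    ring
  -- By `pderiv_cometric_relation`, the kinetic equation says that the derivative of `log f` along
  -- `n` is `q`. Hence `f = exp L` below, which is also positive.
  let q : Plane → ℝ := fun x => (n 0 * pderiv 0 m x + n 1 * pderiv 0 m' x) / m x
  have hq : ∀ᶠ x in 𝓝 0, ContDiffAt ℝ ∞ q x := by
    filter_upwards [hm, hm', hmpos] with x h1 h2 h3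
    exact ((contDiffAt_const.mul (contDiffAt_pderiv h1 0)).add
      (contDiffAt_const.mul (contDiffAt_pderiv h2 0))).div h1 h3.ne'
  obtain ⟨q', hq's, hq'⟩ := exists_contDiff_eventuallyEq hq
  have hn0 : n ≠ 0 := by
    rintro rfl
    simp at hn2
  obtain ⟨L, hL, hLn, -⟩ := exists_fderiv_apply_eq hq's (n := n)
    (ℓ := (‖n‖ ^ 2)⁻¹ • innerSL ℝ n) (by
      have : ‖n‖ ≠ 0 := norm_ne_zero_iff.2 hn0
      simp
      field_simp)
  let f : Plane → ℝ := fun x => Real.exp (L x)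
  have hf : ContDiff ℝ ∞ f := hL.exp
  have hfpos (x : Plane) : 0 < f x := Real.exp_pos _
  -- The potential equation, with `A (1, r) = n / m`, is `∂ₙ v = G`.
  let G : Plane → ℝ := fun x => pderiv 0 h x * (m x / f x)
  have hG : ∀ᶠ x in 𝓝 0, ContDiffAt ℝ ∞ G x := by
    filter_upwards [hm, hh] with x h1 h2
    exact (contDiffAt_pderiv h2 0).mul (h1.div hf.contDiffAt (hfpos x).ne')
  obtain ⟨G', hG's, hG'⟩ := exists_contDiff_eventuallyEq hG
  have hh00 : pderiv 0 h 0 = 0 := by simp [pderiv, hh0]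
  have hG'0 : G' 0 = 0 := by rw [hG'.self_of_nhds]; simp [G, hh00]
  -- Since `h_x` vanishes at the origin, only it gets differentiated.
  have hdG : fderiv ℝ G' 0 n =
      m 0 / f 0 * (fderiv ℝ (fderiv ℝ h) 0 n (EuclideanSpace.single 0 1)) := by
    rw [hG'.fderiv_eq]
    have hhs := hh.self_of_nhds
    have h1 : HasFDerivAt (fderiv ℝ h) (fderiv ℝ (fderiv ℝ h) 0) 0 :=
      ((hhs.fderiv_right (m := ∞) (by simp)).differentiableAt (by simp)).hasFDerivAt
    have h2 : HasFDerivAt (pderiv 0 h)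
        ((fderiv ℝ (fderiv ℝ h) 0).flip (EuclideanSpace.single 0 1)) 0 :=
      (ContinuousLinearMap.apply ℝ ℝ (EuclideanSpace.single 0 1 : Plane)).hasFDerivAt.comp 0 h1
    have h3 := ((hm.self_of_nhds.div hf.contDiffAt (hfpos 0).ne').differentiableAt
      (by simp)).hasFDerivAt
    have h4 : HasFDerivAt G _ 0 := h2.mul h3
    rw [h4.fderiv]
    simp [hh00]
  obtain ⟨v, hv, hvn, hv0, hdv0, hHess⟩ := exists_potential hG's hG'0 (n := n) (by
    rw [hdG]
    refine mul_pos (div_pos hn1 (hfpos 0)) ?_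
    rw [fderiv_fderiv_comm hh.self_of_nhds, clm_plane_apply]
    linarith)
  refine ⟨f, fun x => m' x / m x, v, hv0, hdv0, hHess, ?_⟩
  filter_upwards [ha, hb, hc, hm, hm', hmpos, hrel0, hrel1, hrel0.eventually_nhds,
    hrel1.eventually_nhds, hq', hG',
    eventually_pos_of_fderiv_fderiv_pos hv.contDiffAt hv0 hdv0 hHess]
    with x hax hbx hcx hmx hm'x hpos h0 h1 h0' h1' hqx hGx hvx
  refine ⟨hf.contDiffAt, hm'x.div hmx hpos.ne', hv.contDiffAt, hfpos x, hvx, ?_, ?_⟩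
  · have hdf : HasFDerivAt f _ x := (hL.differentiable (by simp) x).hasFDerivAt.exp
    have e1 : fderiv ℝ f x n = f x * q x := by
      rw [hdf.fderiv]
      simp [hLn, hqx, f]
    rw [fderiv_apply_eq_pderiv] at e1
    have e2 := pderiv_cometric_relation (hax.differentiableAt (by simp))
      (hbx.differentiableAt (by simp)) (hcx.differentiableAt (by simp))
      (hmx.differentiableAt (by simp)) (hm'x.differentiableAt (by simp)) h0' h1'
    have e3 : q x * m x = n 0 * pderiv 0 m x + n 1 * pderiv 0 m' x := by
      simp only [q]; field_simp
    rw [← h0, ← h1] at e1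
    rw [← e3] at e2
    have hρ : m' x = m' x / m x * m x := (div_mul_cancel₀ _ hpos.ne').symm
    generalize m' x / m x = ρ at hρ ⊢
    rw [hρ] at e1 e2
    refine mul_left_cancel₀ (pow_ne_zero 2 hpos.ne') ?_
    linear_combination m x * e1 + f x * e2
  · have e1 := hvn x
    rw [fderiv_apply_eq_pderiv, hGx, ← h0, ← h1] at e1
    simp only [G] at e1
    have hfx := hfpos x
    field_simp at e1 ⊢
    linear_combination e1

end Matching

/-! ### Lyapunov's stability theorem. -/

section Stability

variable {E H P : Type*} [NormedAddCommGroup E] [NormedSpace ℝ E] [TopologicalSpace H]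
  {I : ModelWithCorners ℝ E H} [TopologicalSpace P] [ChartedSpace H P]
  {X : ∀ α : P, TangentSpace I α} {O : Set P} {α₀ : P} {V : P → ℝ}

theorem IsLyapunovFunction.hasFDerivWithinAt (hV : IsLyapunovFunction I X O α₀ V)
    (hO : IsOpen O) {s : Set ℝ} {Γ : ℝ → P} (hΓ : IsMIntegralCurveOn (I := I) Γ X s) {t : ℝ}
    (ht : t ∈ s) (htO : Γ t ∈ O) : ∃ L : ℝ →L[ℝ] ℝ, L 1 ≤ 0 ∧
      HasFDerivWithinAt (fun t => V (Γ t)) L s t := by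
  have h1 := ((hV.smooth _ htO).contMDiffAt (hO.mem_nhds htO)).mdifferentiableAt (by simp)
  have h2 := h1.hasMFDerivAt.comp_hasMFDerivWithinAt t (hΓ t ht)
  refine ⟨_, ?_, h2.hasFDerivWithinAt⟩
  change differential I V (Γ t) ((1 : ℝ) • X (Γ t)) ≤ 0
  rw [one_smul]
  exact hV.deriv_nonpos _ htO

theorem IsLyapunovFunction.antitoneOn (hV : IsLyapunovFunction I X O α₀ V)
    (hO : IsOpen O) {T : ℝ} {Γ : ℝ → P} (hΓ : IsMIntegralCurveOn (I := I) Γ X (Ico 0 T))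
    (hΓO : ∀ t ∈ Ico 0 T, Γ t ∈ O) : AntitoneOn (fun t => V (Γ t)) (Ico 0 T) := by
  have key {t : ℝ} (ht : t ∈ Ico 0 T) := hV.hasFDerivWithinAt hO hΓ ht (hΓO t ht)
  have hint {t : ℝ} (ht : t ∈ interior (Ico 0 T)) : ∃ d ≤ 0, HasDerivAt (fun t => V (Γ t)) d t := by
    obtain ⟨L, hL, hd⟩ := key (interior_subset ht)
    exact ⟨L 1, hL, (hd.hasFDerivAt (mem_interior_iff_mem_nhds.1 ht)).hasDerivAt⟩
  refine antitoneOn_of_deriv_nonpos (convex_Ico 0 T) (fun t ht => ?_) (fun t ht => ?_)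
    fun t ht => ?_
  · obtain ⟨L, -, hd⟩ := key ht
    exact hd.continuousWithinAt
  · obtain ⟨d, -, hd⟩ := hint ht
    exact hd.differentiableAt.differentiableWithinAt
  · obtain ⟨d, hd0, hd⟩ := hint ht
    rwa [hd.deriv]

/-- A critical point with a Lyapunov function on the domain of a chart is stable. -/
theorem IsLyapunovFunction.isStableAt {F : Type*} [PseudoMetricSpace F] [ProperSpace F]
    (hV : IsLyapunovFunction I X O α₀ V) (hO : IsOpen O) (hα₀ : α₀ ∈ O)
    (e : OpenPartialHomeomorph P F) (he : O ⊆ e.source) : IsStableAt I X O α₀ := by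
  intro N hN
  have hNO : e.target ∩ e.symm ⁻¹' (N ∩ O) ∈ 𝓝 (e α₀) := by
    refine inter_mem (e.open_target.mem_nhds (e.map_source (he hα₀))) ?_
    refine (e.continuousAt_symm (e.map_source (he hα₀))) ?_
    rw [e.left_inv (he hα₀)]
    exact inter_mem hN (hO.mem_nhds hα₀)
  obtain ⟨ε, hε, hball⟩ := Metric.nhds_basis_closedBall.mem_iff.1 hNO
  have hcont : ContinuousOn (fun w => V (e.symm w)) (Metric.sphere (e α₀) ε) := by
    have hsub := Metric.sphere_subset_closedBall.trans hball
    exact hV.smooth.continuousOn.comp (e.continuousOn_symm.mono fun w hw => (hsub hw).1)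
      fun w hw => (hsub hw).2.2
  -- Compactness is that of a small sphere in the chart, on which `V` is bounded below by some `m >
  -- 0`.
  obtain ⟨m, hm, hmin⟩ := (isCompact_sphere (e α₀) ε).exists_forall_le' hcont (a := 0)
    fun w hw => by
      have hw' := hball (Metric.sphere_subset_closedBall hw)
      refine hV.pos _ hw'.2.2 fun h => hε.ne ?_
      rw [Metric.mem_sphere, ← e.right_inv hw'.1, h, dist_self] at hw
      exact hw
  refine ⟨O ∩ e ⁻¹' Metric.ball (e α₀) ε ∩ V ⁻¹' Iio m, ?_, ?_⟩
  · refine inter_mem (inter_mem (hO.mem_nhds hα₀)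
      ((e.continuousAt (he hα₀)) (Metric.ball_mem_nhds _ hε))) ?_
    refine (hV.smooth.continuousOn.continuousAt (hO.mem_nhds hα₀)) (Iio_mem_nhds ?_)
    rwa [hV.zero]
  · rintro T Γ hΓ hΓO ⟨⟨-, h0⟩, hV0⟩ t ht
    have hΓc : ContinuousOn Γ (Ico 0 T) := fun t ht => (hΓ t ht).continuousWithinAt
    have hsub : Icc 0 t ⊆ Ico 0 T := fun s hs => ⟨hs.1, hs.2.trans_lt ht.2⟩
    have hd : dist (e (Γ t)) (e α₀) < ε := by
      -- To leave the ball, the trajectory must meet the sphere, where `V ≥ m`; but `V` starts below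
      -- `m` and does not increase.
      by_contra! hge
      have hcd : ContinuousOn (fun s => dist (e (Γ s)) (e α₀)) (Icc 0 t) :=
        (continuous_id.dist continuous_const).comp_continuousOn
          ((e.continuousOn.comp hΓc fun s hs => he (hΓO s hs)).mono hsub)
      obtain ⟨s, hs, hs'⟩ := intermediate_value_Icc ht.1 hcd ⟨le_of_lt h0, hge⟩
      have h1 := hmin _ (Metric.mem_sphere.2 hs')
      rw [e.left_inv (he (hΓO s (hsub hs)))] at h1
      have h2 := hV.antitoneOn hO hΓ hΓO (hsub ⟨le_rfl, ht.1⟩) (hsub hs) hs.1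
      exact (h1.trans h2).not_gt hV0
    have h3 := (hball (Metric.ball_subset_closedBall (Metric.mem_ball.2 hd))).2.1
    rwa [e.left_inv (he (hΓO t ht))] at h3

end Stability

/-! ### Sufficiency: the control law and the Lyapunov function on the bundle. -/

section Sufficiency

variable {Q : Type*} [TopologicalSpace Q] [ChartedSpace Plane Q] [IsManifold 𝓘(ℝ, Plane) ∞ Q]
  {φ : OpenPartialHomeomorph Q Plane}
  {g : ∀ q : Q, TangentSpace 𝓘(ℝ, Plane) q →L[ℝ] TangentSpace 𝓘(ℝ, Plane) q →L[ℝ] ℝ} {U : Set Q}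

theorem isOpen_proj_preimage (hU : IsOpen U) : IsOpen {α : CotangentBundle Q | α.proj ∈ U} :=
  hU.preimage (FiberBundle.continuous_proj (Plane →L[ℝ] ℝ)
    (fun q : Q => TangentSpace 𝓘(ℝ, Plane) q →L[ℝ] ℝ))

/-- The chart of the cotangent bundle induced by a chart of the base. -/
def cotangentChart (hφ : φ ∈ IsManifold.maximalAtlas 𝓘(ℝ, Plane) ∞ Q) :
    OpenPartialHomeomorph (CotangentBundle Q) (Plane × Plane) where
  toFun := cotangentCoord φ
  invFun := cotangentCoordSymm φ
  source := {α | α.proj ∈ φ.source}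
  target := φ.target ×ˢ univ
  map_source' _ hα := ⟨φ.map_source hα, mem_univ _⟩
  map_target' _ hz := φ.map_target hz.1
  left_inv' _ hα := cotangentCoordSymm_cotangentCoord hφ hα
  right_inv' _ hz := cotangentCoord_cotangentCoordSymm hφ hz.1
  open_source := isOpen_proj_preimage φ.open_source
  open_target := φ.open_target.prod isOpen_univ
  continuousOn_toFun _ hα := (contMDiffAt_cotangentCoord hφ hα).continuousAt.continuousWithinAt
  continuousOn_invFun _ hz :=
    (contMDiffAt_cotangentCoordSymm hφ hz.1).continuousAt.continuousWithinAt

/-- The metric is chosen with determinant one, so its inverse is its adjugate. -/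
theorem localCometric_coordMetric (hφ : φ ∈ IsManifold.maximalAtlas 𝓘(ℝ, Plane) ∞ Q)
    {f r : Plane → ℝ}
    (hg : IsRiemannianMetricOn
      (coordMetric φ f (fun x => r x * f x) fun x => (f x)⁻¹ + r x ^ 2 * f x) U)
    {x : Plane} (hx : x ∈ φ.target) (hxU : φ.symm x ∈ U) (hf : f x ≠ 0) :
    localCometric φ (coordMetric φ f (fun x => r x * f x) fun x => (f x)⁻¹ + r x ^ 2 * f x) 0 0 x =
      (f x)⁻¹ + r x ^ 2 * f x ∧
    localCometric φ (coordMetric φ f (fun x => r x * f x) fun x => (f x)⁻¹ + r x ^ 2 * f x) 0 1 x =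
      -(r x * f x) ∧
    localCometric φ (coordMetric φ f (fun x => r x * f x) fun x => (f x)⁻¹ + r x ^ 2 * f x) 1 1 x =
      f x := by
  obtain ⟨h0, h1, h2⟩ := metricCoeff_coordMetric hφ f (fun x => r x * f x)
    (fun x => (f x)⁻¹ + r x ^ 2 * f x) (φ.map_target hx)
  simp only [φ.right_inv hx] at h0 h1 h2
  obtain ⟨c0, c1, -, c2⟩ := localCometric_eq hφ hg hx hxU (D := 1) (by
    simp only [localMetric, h0, h1, h2]
    field_simp
    ring)
  rw [c0, c1, c2]
  simp only [localMetric, h0, h1, h2, div_one, and_self]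

theorem localSimple_coordMetric (hφ : φ ∈ IsManifold.maximalAtlas 𝓘(ℝ, Plane) ∞ Q)
    {f r : Plane → ℝ} (v : Plane → ℝ)
    (hg : IsRiemannianMetricOn
      (coordMetric φ f (fun x => r x * f x) fun x => (f x)⁻¹ + r x ^ 2 * f x) U)
    {z : Plane × Plane} (hx : z.1 ∈ φ.target) (hxU : φ.symm z.1 ∈ U) (hf : f z.1 ≠ 0) :
    localSimple φ (coordMetric φ f (fun x => r x * f x) fun x => (f x)⁻¹ + r x ^ 2 * f x)
      (fun q => v (φ q)) z =
      planeSimple (fun x => (f x)⁻¹ + r x ^ 2 * f x) (fun x => -(r x * f x)) f v z := by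
  obtain ⟨h0, h1, h2⟩ := localCometric_coordMetric hφ hg hx hxU hf
  simp only [localSimple, planeSimple, h0, h1, h2, φ.right_inv hx]

theorem planeSimple_pos {f r v : Plane → ℝ} {z : Plane × Plane} (hf : 0 < f z.1)
    (hv0 : v 0 = 0) (hv : z.1 ≠ 0 → 0 < v z.1) (hz : z ≠ 0) :
    0 < planeSimple (fun x => (f x)⁻¹ + r x ^ 2 * f x) (fun x => -(r x * f x)) f v z := by
  have hkin : 1 / 2 * (((f z.1)⁻¹ + r z.1 ^ 2 * f z.1) * z.2 0 ^ 2 +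
      2 * -(r z.1 * f z.1) * z.2 0 * z.2 1 + f z.1 * z.2 1 ^ 2) =
      1 / 2 * ((f z.1)⁻¹ * z.2 0 ^ 2 + f z.1 * (z.2 1 - r z.1 * z.2 0) ^ 2) := by ring
  have h0 : 0 ≤ (f z.1)⁻¹ * z.2 0 ^ 2 := by positivity
  have h1 : 0 ≤ f z.1 * (z.2 1 - r z.1 * z.2 0) ^ 2 := by positivity
  unfold planeSimple
  rw [hkin]
  by_cases hx : z.1 = 0
  · have hp : z.2 ≠ 0 := fun hp => hz (Prod.ext hx hp)
    have hv' : v z.1 = 0 := by rw [hx, hv0]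
    rw [hv', add_zero]
    by_cases hp0 : z.2 0 = 0
    · have hp1 : z.2 1 ≠ 0 := fun hp1 => hp (by ext i; fin_cases i <;> simp [hp0, hp1])
      rw [hp0]
      have : 0 < f z.1 * z.2 1 ^ 2 := by positivity
      simpa using this
    · have : 0 < (f z.1)⁻¹ * z.2 0 ^ 2 := by positivity
      linarith
  · have := hv hx
    linarith

theorem matchingForce_zero {a b c h f r v : Plane → ℝ} (hh : fderiv ℝ h 0 = 0)
    (hv : fderiv ℝ v 0 = 0) : matchingForce a b c h f r v 0 = 0 := by
  simp [matchingForce, pderiv, hh, hv]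

/-- The control law on the cotangent bundle given by a force in the direction `dy`. -/
def controlLaw (φ : OpenPartialHomeomorph Q Plane) (u : Plane × Plane → ℝ)
    (α : CotangentBundle Q) : TangentSpace cotangentModel α :=
  cotangentDeriv φ (cotangentCoord φ α) (0, EuclideanSpace.single 1 (u (cotangentCoord φ α)))

theorem contMDiffAt_controlLaw (hφ : φ ∈ IsManifold.maximalAtlas 𝓘(ℝ, Plane) ∞ Q)
    {u : Plane × Plane → ℝ} {α : CotangentBundle Q} (hα : α.proj ∈ φ.source)
    (hu : ContDiffAt ℝ ∞ u (cotangentCoord φ α)) :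
    ContMDiffAt cotangentModel cotangentModel.tangent ∞
      (fun α => (⟨α, controlLaw φ u α⟩ : TangentBundle cotangentModel (CotangentBundle Q))) α := by
  refine contMDiffAt_pushforward (S := φ.target ×ˢ univ) (φ.open_target.prod isOpen_univ)
    (fun z hz => (contMDiffAt_cotangentCoordSymm hφ hz.1).contMDiffWithinAt)
    (contMDiffAt_cotangentCoord hφ hα) ⟨φ.map_source hα, mem_univ _⟩ ?_
    (X := fun z => (0, EuclideanSpace.single 1 (u z))) ?_
  · filter_upwards [(isOpen_proj_preimage φ.open_source).mem_nhds hα] with β hβ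
    exact cotangentCoordSymm_cotangentCoord hφ hβ
  · refine contDiffAt_const.prodMk ?_
    rw [contDiffAt_piLp]
    intro i
    fin_cases i
    · simpa using contDiffAt_const
    · simpa using hu

theorem controlLaw_cotangentCoordSymm (hφ : φ ∈ IsManifold.maximalAtlas 𝓘(ℝ, Plane) ∞ Q)
    (u : Plane × Plane → ℝ) {z : Plane × Plane} (hz : z.1 ∈ φ.target) :
    controlLaw φ u (cotangentCoordSymm φ z) =
      cotangentDeriv φ z (0, EuclideanSpace.single 1 (u z)) := by
  change cotangentDeriv φ (cotangentCoord φ (cotangentCoordSymm φ z))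
    (0, EuclideanSpace.single 1 (u (cotangentCoord φ (cotangentCoordSymm φ z)))) = _
  rw [cotangentCoord_cotangentCoordSymm hφ hz]

theorem controlLaw_mem_actuation (hφ : φ ∈ IsManifold.maximalAtlas 𝓘(ℝ, Plane) ∞ Q)
    {ξ : ∀ q : Q, TangentSpace 𝓘(ℝ, Plane) q →L[ℝ] ℝ} (hξ : IsAdapted φ ξ)
    (u : Plane × Plane → ℝ) {α : CotangentBundle Q} (hα : α.proj ∈ φ.source) :
    controlLaw φ u α ∈ actuation ξ α := by
  obtain ⟨z, hz, rfl⟩ : ∃ z : Plane × Plane, z.1 ∈ φ.target ∧ cotangentCoordSymm φ z = α :=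
    ⟨_, φ.map_source hα, cotangentCoordSymm_cotangentCoord hφ hα⟩
  exact (mem_actuation_iff hφ hξ hz _).2 ⟨_, controlLaw_cotangentCoordSymm hφ u hz⟩

/-- At zero momentum the momentum components of the Hamiltonian field are `-dh`. -/
theorem fderiv_local_eq_zero (hφ : φ ∈ IsManifold.maximalAtlas 𝓘(ℝ, Plane) ∞ Q)
    (hg : IsRiemannianMetricOn g univ) {h : Q → ℝ} (hh : ContMDiff 𝓘(ℝ, Plane) 𝓘(ℝ, ℝ) ∞ h)
    {q₀ : Q} (hq₀ : q₀ ∈ φ.source)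
    (hcrit : hamiltonianField φ (simpleFunction g h) (covector q₀ 0) = 0) :
    fderiv ℝ (fun x => h (φ.symm x)) (φ q₀) = 0 := by
  have hx := φ.map_source hq₀
  have h1 : cotangentCoordSymm φ (φ q₀, 0) = covector q₀ 0 := by
    rw [cotangentCoordSymm_zero, φ.left_inv hq₀]
  have h2 := hamiltonianField_simpleFunction hφ hg isOpen_univ h (z := (φ q₀, 0)) hx (mem_univ _)
  rw [h1, hcrit] at h2
  have h3 : planeField (localSimple φ g h) (φ q₀, 0) = 0 :=
    cotangentDeriv_injective hφ (z := (φ q₀, 0)) hx (h2.symm.trans (map_zero _).symm)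
  have hA (i j : Fin 2) := (contDiffAt_localCometric hφ hg isOpen_univ hx
    (mem_univ _) i j).differentiableAt (by simp)
  have h4 (i : Fin 2) :
      fderiv ℝ (fun x => h (φ.symm x)) (φ q₀) (EuclideanSpace.single i 1) = 0 := by
    have h5 := congrArg (fun X : Plane × Plane => X.2 i) h3
    simp only [planeField, localSimple] at h5
    rw [fderiv_planeSimple (hA 0 0) (hA 0 1) (hA 1 1)
      ((contDiffAt_local hφ hx (hh _)).differentiableAt (by simp))] at h5
    simpa using h5
  ext u
  rw [clm_plane_apply, h4, h4]
  simp

theorem stabilizable_of_matching (hφ : φ ∈ IsManifold.maximalAtlas 𝓘(ℝ, Plane) ∞ Q)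
    (hg : IsRiemannianMetricOn g univ) {h : Q → ℝ} (hh : ContMDiff 𝓘(ℝ, Plane) 𝓘(ℝ, ℝ) ∞ h)
    {ξ : ∀ q : Q, TangentSpace 𝓘(ℝ, Plane) q →L[ℝ] ℝ} (hξ : IsAdapted φ ξ)
    {q₀ : Q} (hq₀ : q₀ ∈ φ.source) (hφ₀ : φ q₀ = 0)
    (hcrit : hamiltonianField φ (simpleFunction g h) (covector q₀ 0) = 0)
    {a b c l f r v : Plane → ℝ} (ha : a = localCometric φ g 0 0) (hb : b = localCometric φ g 0 1)
    (hc : c = localCometric φ g 1 1) (hl : l = fun x => h (φ.symm x))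
    (hv0 : v 0 = 0) (hdv : fderiv ℝ v 0 = 0)
    (hhess : ∀ u, u ≠ 0 → 0 < fderiv ℝ (fderiv ℝ v) 0 u u)
    (hev : ∀ᶠ x in 𝓝 0, ContDiffAt ℝ ∞ f x ∧ ContDiffAt ℝ ∞ r x ∧ ContDiffAt ℝ ∞ v x ∧ 0 < f x ∧
      (x ≠ 0 → 0 < v x) ∧
      ((a x + b x * r x) * pderiv 0 f x + (b x + c x * r x) * pderiv 1 f x =
        -(f x * (pderiv 0 a x + 2 * pderiv 0 b x * r x + pderiv 0 c x * r x ^ 2))) ∧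
      f x * ((a x + b x * r x) * pderiv 0 v x + (b x + c x * r x) * pderiv 1 v x) =
        pderiv 0 l x) :
    StabilizableBySimpleLyapunov φ (simpleFunction g h) ξ q₀ := by
  obtain ⟨W, hW, hWo, h0W⟩ := eventually_nhds_iff.1 hev
  set U : Set Q := φ.source ∩ φ ⁻¹' W with hUdef
  have hU : IsOpen U := φ.isOpen_inter_preimage hWo
  have hq₀U : q₀ ∈ U := ⟨hq₀, by simpa [hφ₀] using h0W⟩
  have hsymmU {x : Plane} (hx : x ∈ φ.target) (hxW : x ∈ W) : φ.symm x ∈ U :=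
    ⟨φ.map_target hx, by simpa [φ.right_inv hx] using hxW⟩
  set G := coordMetric φ f (fun x => r x * f x) fun x => (f x)⁻¹ + r x ^ 2 * f x with hGdef
  have hG : IsRiemannianMetricOn G U := by
    refine isRiemannianMetricOn_coordMetric hφ inter_subset_left (fun q hq => ?_) fun q hq => ?_
    · obtain ⟨h1, h2, -, h4, -⟩ := hW _ hq.2
      exact ⟨h1, h2.mul h1, (h1.inv h4.ne').add ((h2.pow 2).mul h1)⟩
    · obtain ⟨-, -, -, h4, -⟩ := hW _ hq.2
      refine ⟨h4, ?_⟩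
      have : f (φ q) * ((f (φ q))⁻¹ + r (φ q) ^ 2 * f (φ q)) - (r (φ q) * f (φ q)) ^ 2 = 1 := by
        field_simp
        ring
      rw [this]
      exact one_pos
  have hvU : ContMDiffOn 𝓘(ℝ, Plane) 𝓘(ℝ, ℝ) ∞ (fun q => v (φ q)) U := fun q hq =>
    ((hW _ hq.2).2.2.1.contMDiffAt.comp q
      (contMDiffAt_of_mem_maximalAtlas hφ hq.1)).contMDiffWithinAt
  have hα₀ : cotangentCoordSymm φ (0 : Plane × Plane) = covector q₀ 0 := by
    have h1 := cotangentCoordSymm_zero (φ := φ) 0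
    rwa [← hφ₀, φ.left_inv hq₀, hφ₀] at h1
  have h0t : (0 : Plane) ∈ φ.target := hφ₀ ▸ φ.map_source hq₀
  -- No bound on the momenta is needed: over `U`, `V` is positive off the critical point and
  -- conserved at every momentum.
  set O : Set (CotangentBundle Q) := {α | α.proj ∈ U} with hOdef
  have hO : IsOpen O := isOpen_proj_preimage hU
  have hα₀O : covector q₀ 0 ∈ O := hq₀U
  have hpar {α : CotangentBundle Q} (hα : α ∈ O) : ∃ z : Plane × Plane, z.1 ∈ φ.target ∧
      z.1 ∈ W ∧ cotangentCoordSymm φ z = α :=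
    ⟨cotangentCoord φ α, φ.map_source hα.1, hα.2, cotangentCoordSymm_cotangentCoord hφ hα.1⟩
  have hcom (i j : Fin 2) {x : Plane} (hx : x ∈ φ.target) :=
    contDiffAt_localCometric hφ hg isOpen_univ hx (mem_univ _) i j
  have hlx {x : Plane} (hx : x ∈ φ.target) : ContDiffAt ℝ ∞ l x :=
    hl ▸ contDiffAt_local hφ hx (hh _)
  set u := matchingForce a b c l f r v with hu
  have hu0 : u 0 = 0 := matchingForce_zero
    (by rw [hl, ← hφ₀]; exact fderiv_local_eq_zero hφ hg hh hq₀ hcrit) hdv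
  have hloc : localSimple φ g h = planeSimple a b c l := by rw [ha, hb, hc, hl]; rfl
  have hLyap : IsLyapunovFunction cotangentModel
      (fun α => hamiltonianField φ (simpleFunction g h) α + controlLaw φ u α) O (covector q₀ 0)
      (simpleFunction G fun q => v (φ q)) := by
    refine ⟨?_, fun α hα => ?_, ?_, fun α hα hne => ?_, fun α hα => ?_⟩
    · have h1 : controlLaw φ u (covector q₀ 0) = 0 := by
        rw [← hα₀]
        refine (controlLaw_cotangentCoordSymm hφ u h0t).trans ?_
        have h2 : ((0, EuclideanSpace.single 1 (u 0)) : Plane × Plane) = 0 := by simp [hu0]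
        rw [h2]
        exact map_zero (cotangentDeriv φ (0 : Plane × Plane))
      rw [hcrit, h1, add_zero]
    · obtain ⟨z, hz, hzW, rfl⟩ := hpar hα
      exact (contMDiffAt_simpleFunction hφ hG hU hvU hz (hsymmU hz hzW)).contMDiffWithinAt
    · simp [simpleFunction, hφ₀, hv0]
    · obtain ⟨z, hz, hzW, rfl⟩ := hpar hα
      obtain ⟨-, -, -, hf, hvpos, -⟩ := hW _ hzW
      rw [simpleFunction_cotangentCoordSymm hφ hG _ hz (hsymmU hz hzW)]
      refine (planeSimple_pos (r := r) hf hv0 hvpos fun h0 => hne (by rw [h0, hα₀])).trans_eq ?_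
      exact (localSimple_coordMetric hφ v hG hz (hsymmU hz hzW) hf.ne').symm
    · obtain ⟨z, hz, hzW, rfl⟩ := hpar hα
      obtain ⟨h1, h2, h3, hf, -, hkin, hpot⟩ := hW _ hzW
      rw [differential_simpleFunction hφ hg isOpen_univ h hG hU hvU hz (mem_univ _)
        (hsymmU hz hzW) _ (controlLaw_cotangentCoordSymm hφ u hz), hloc]
      have heq : localSimple φ G (fun q => v (φ q)) =ᶠ[𝓝 z]
          planeSimple (fun x => (f x)⁻¹ + r x ^ 2 * f x) (fun x => -(r x * f x)) f v := by
        filter_upwards [continuousAt_fst.eventually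
          ((φ.open_target.inter hWo).mem_nhds ⟨hz, hzW⟩)] with z' hz'
        exact localSimple_coordMetric hφ v hG hz'.1 (hsymmU hz'.1 hz'.2) (hW _ hz'.2).2.2.2.1.ne'
      rw [heq.fderiv_eq]
      have hd {F : Plane → ℝ} (hF : ContDiffAt ℝ ∞ F z.1) : DifferentiableAt ℝ F z.1 :=
        hF.differentiableAt (by simp)
      -- The Lyapunov inequality holds as an equality.
      exact (fderiv_planeSimple_matchingForce (hd (ha ▸ hcom 0 0 hz)) (hd (hb ▸ hcom 0 1 hz))
        (hd (hc ▸ hcom 1 1 hz)) (hd (hlx hz)) (hd h1) (hd h2) (hd h3) hf.ne' hkin hpot).le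
  refine ⟨U, O, controlLaw φ u, G, fun q => v (φ q), hU, hq₀U, inter_subset_left, hO, hα₀O,
    fun α hα => hα, fun α hα => ?_, fun α hα => controlLaw_mem_actuation hφ hξ u hα.1,
    hLyap.isStableAt hO hα₀O (cotangentChart hφ) fun α hα => hα.1, hG, hvU, hLyap,
    fun w hw => ?_⟩
  · obtain ⟨h1, h2, h3, hf, -⟩ := hW _ hα.2
    have hz := φ.map_source hα.1
    exact (contMDiffAt_controlLaw hφ hα.1 (contDiffAt_matchingForce (ha ▸ hcom 0 0 hz)
      (hb ▸ hcom 0 1 hz) (hc ▸ hcom 1 1 hz) (hlx hz) h1 h2 h3 hf.ne')).contMDiffWithinAt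
  · have heq : (fun x => v (φ (φ.symm x))) =ᶠ[𝓝 0] v := by
      filter_upwards [φ.open_target.mem_nhds h0t] with x hx
      rw [φ.right_inv hx]
    unfold hessian
    rw [hφ₀, heq.fderiv.fderiv_eq]
    exact hhess w hw

theorem stabilizable_of_condition (hφ : φ ∈ IsManifold.maximalAtlas 𝓘(ℝ, Plane) ∞ Q)
    (hg : IsRiemannianMetricOn g univ) {h : Q → ℝ} (hh : ContMDiff 𝓘(ℝ, Plane) 𝓘(ℝ, ℝ) ∞ h)
    {ξ : ∀ q : Q, TangentSpace 𝓘(ℝ, Plane) q →L[ℝ] ℝ} (hξ : IsAdapted φ ξ)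
    {q₀ : Q} (hq₀ : q₀ ∈ φ.source) (hφ₀ : φ q₀ = 0)
    (hcrit : hamiltonianField φ (simpleFunction g h) (covector q₀ 0) = 0)
    (hcond : cometricCoeff φ g 0 1 q₀ * secondPartial φ h 0 0 q₀ +
        cometricCoeff φ g 1 1 q₀ * secondPartial φ h 0 1 q₀ ≠ 0 ∨
      0 < secondPartial φ h 0 0 q₀) :
    StabilizableBySimpleLyapunov φ (simpleFunction g h) ξ q₀ := by
  have h0t : (0 : Plane) ∈ φ.target := hφ₀ ▸ φ.map_source hq₀
  have hsymm : φ.symm 0 = q₀ := by rw [← hφ₀, φ.left_inv hq₀]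
  have hcom (i j : Fin 2) : ∀ᶠ x in 𝓝 0, ContDiffAt ℝ ∞ (localCometric φ g i j) x := by
    filter_upwards [φ.open_target.mem_nhds h0t] with x hx
    exact contDiffAt_localCometric hφ hg isOpen_univ hx (mem_univ _) i j
  have hl : ∀ᶠ x in 𝓝 0, ContDiffAt ℝ ∞ (fun x => h (φ.symm x)) x := by
    filter_upwards [φ.open_target.mem_nhds h0t] with x hx
    exact contDiffAt_local hφ hx (hh _)
  obtain ⟨c0, c1, -, c2⟩ := localCometric_eq hφ hg h0t (mem_univ _) rfl
  have hD := localMetric_det_pos hφ hg h0t (mem_univ _)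
  have hM := localMetric_zero_zero_pos hφ hg h0t (mem_univ _)
  have hh0 : fderiv ℝ (fun x => h (φ.symm x)) 0 = 0 := by
    rw [← hφ₀]
    exact fderiv_local_eq_zero hφ hg hh hq₀ hcrit
  obtain ⟨f, r, v, hv0, hdv, hhess, hev⟩ := exists_matching (hcom 0 0) (hcom 0 1) (hcom 1 1) hl
    (c2 ▸ div_pos hM hD) (by
      rw [c0, c1, c2]
      set D := localMetric φ g 0 0 0 * localMetric φ g 1 1 0 - localMetric φ g 0 1 0 ^ 2 with hDdef
      have : localMetric φ g 1 1 0 / D * (localMetric φ g 0 0 0 / D) -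
          (-localMetric φ g 0 1 0 / D) ^ 2 = D / D ^ 2 := by
        field_simp
        linear_combination -hDdef
      rw [this]
      positivity) hh0 (by
      simpa only [localCometric, hsymm, secondPartial, hessian, hφ₀] using hcond)
  exact stabilizable_of_matching hφ hg hh hξ hq₀ hφ₀ hcrit rfl rfl rfl rfl hv0 hdv hhess hev

end Sufficiency

end Underactuated

end

theorem mainTheorem2 {Q : Type*} [TopologicalSpace Q] [T2Space Q]
    [ChartedSpace Underactuated.Plane Q] [IsManifold 𝓘(ℝ, Underactuated.Plane) ∞ Q]
    (ρ : ContMDiffRiemannianMetric 𝓘(ℝ, Underactuated.Plane) ∞ Underactuated.Plane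
      (fun q : Q => TangentSpace 𝓘(ℝ, Underactuated.Plane) q))
    (h : Q → ℝ) (hh : ContMDiff 𝓘(ℝ, Underactuated.Plane) 𝓘(ℝ, ℝ) ∞ h)
    (ξ : ∀ q : Q, TangentSpace 𝓘(ℝ, Underactuated.Plane) q →L[ℝ] ℝ)
    (hξ : ContMDiff 𝓘(ℝ, Underactuated.Plane) Underactuated.cotangentModel ∞
      (fun q => Underactuated.covector q (ξ q)))
    (hξ_ne : ∀ q, ξ q ≠ 0)
    (q₀ : Q) (φ : OpenPartialHomeomorph Q Underactuated.Plane)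
    (hφ : φ ∈ IsManifold.maximalAtlas 𝓘(ℝ, Underactuated.Plane) ∞ Q)
    (hq₀ : q₀ ∈ φ.source) (hφ₀ : φ q₀ = 0)
    (hadapted : Underactuated.IsAdapted φ ξ)
    (hcrit : Underactuated.hamiltonianField φ (Underactuated.simpleFunction ρ.inner h)
      (Underactuated.covector q₀ 0) = 0) :
    Underactuated.StabilizableBySimpleLyapunov φ
        (Underactuated.simpleFunction ρ.inner h) ξ q₀ ↔
      (Underactuated.cometricCoeff φ ρ.inner 0 1 q₀ * Underactuated.secondPartial φ h 0 0 q₀ +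
          Underactuated.cometricCoeff φ ρ.inner 1 1 q₀ * Underactuated.secondPartial φ h 0 1 q₀
            ≠ 0 ∨
        0 < Underactuated.secondPartial φ h 0 0 q₀) := by
  refine ⟨fun hstab => ?_, Underactuated.stabilizable_of_condition hφ
    (Underactuated.isRiemannianMetricOn_inner ρ) hh hadapted hq₀ hφ₀ hcrit⟩
  by_contra! hcond
  exact (Underactuated.pos_of_stabilizable hφ (Underactuated.isRiemannianMetricOn_inner ρ) hh
    hadapted hq₀ hstab hcond.1).not_ge hcond.2
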